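/- Let $q\ge 0$ and $n_1,\dots,n_q\ge 0$ be integers, let $B^{m}=\{z\in\mathbb{C}^{m}:\|z\|<1\}$ be the open Euclidean unit ball, and let $M=B^{n_1}\times\cdots\times B^{n_q}$ with basepoint $b=0$. Let $d=k_M$ be the Kobayashi distance $$k_M(z,w)=\inf\{\rho(\zeta,\eta):\ f(\zeta)=z,\ f(\eta)=w \text{ for some holomorphic } f\colon\Delta\to M\},\qquad \rho(\zeta,\eta)=\log\frac{1+\left|\frac{\eta-\zeta}{1-\bar\zeta\eta}\right|}{1-\left|\frac{\eta-\zeta}{1-\bar\zeta\eta}\right|},$$ where $\Delta$ is the open unit disc in $\mathbb{C}$. For $y\in M$ put $h_y(z)=d(z,y)-d(b,y)$. A horofunction is an element of the closure of $\{h_y:y\in M\}$ in $\mathbb{R}^M$ (topology of pointwise convergence) that is not one of the $h_y$. A sequence $(y^k)_{k\ge 0}$ in $M$ is almost geodesic if $d(y^k,y^0)\to\infty$ and for each $\varepsilon>0$ there is $N$ with $d(y^m,y^k)+d(y^k,y^0)-d(y^m,y^0)<\varepsilon$ for all $m\ge k\ge N$. A Busemann point is a horofunction that is the pointwise limit of $(h_{y^k})$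 for some almost geodesic sequence $(y^k)$. The detour distance is $\delta(h,h')=H(h,h')+H(h',h)\in[0,\infty]$, where $H(h,h')=\inf_{(z^k)}\liminf_{k}\,\big(d(b,z^k)+h'(z^k)\big)$, the infimum being over all sequences $(z^k)$ in $M$ with $h_{z^k}\to h$ pointwise. The part $\mathcal{P}(h)$ of a Busemann point $h$ is the set of all Busemann points $h'$ with $\delta(h,h')<\infty$. For a finite nonempty set $J$, the quotient of $\mathbb{R}^J$ by the line $\mathrm{Sp}(\mathbf 1)$ of constant vectors carries the norm $\|\bar x\|_{\mathrm{var}}=\max_{j\in J}x_j+\max_{j\in J}(-x_j)$. Then the following hold. 1. The horofunctions of $(M,k_M)$ with basepoint $0$ are precisely the functions $$h(z)=\max_{j\in J}\left(\log\frac{|1-\langle z_j,\xi_j\rangle|^2}{1-\|z_j\|^2}-\alpha_j\right),\qquad z=(z_1,\dots,z_q)\in M,$$ where $J\subseteq\{1,\dots,q\}$ is nonempty, $\xi_j\in\partial B^{n_j}$ (that is, $\xi_j\in\mathbb{C}^{n_j}$ and $\|\xi_j\|=1$) for $j\in J$, and $\alpha\in\mathbb{R}^J$ satisfies $\min_{j\in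 J}\alpha_j=0$. 2. Every horofunction is a Busemann point. 3. If $h$ is of the form in 1, with index set $J$, then $(\mathcal{P}(h),\delta)$ is isometric to $(\mathbb{R}^J/\mathrm{Sp}(\mathbf{1}),\|\cdot\|_{\mathrm{var}})$: there is a bijection $\Phi\colon\mathcal{P}(h)\to\mathbb{R}^J/\mathrm{Sp}(\mathbf 1)$ with $\delta(h_1,h_2)=\|\Phi(h_1)-\Phi(h_2)\|_{\mathrm{var}}$ for all $h_1,h_2\in\mathcal{P}(h)$. -/

import Mathlib

/-! ### The Kobayashi distance -/

namespace KobHoro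

/-- The hyperbolic distance `log ((1 + m) / (1 - m))`, with `m = |(w - z) / (1 - z̄ w)|`, on the
unit disc of `ℂ`. -/
noncomputable def hyperbolicDist (z w : ℂ) : ℝ :=
  Real.log ((1 + ‖(w - z) / (1 - (starRingEnd ℂ) z * w)‖) /
    (1 - ‖(w - z) / (1 - (starRingEnd ℂ) z * w)‖))

/-- The Kobayashi distance of a convex domain `D`: the infimum of the hyperbolic distances
`ρ(ζ, η)` over all `ζ, η` in the unit disc for which some holomorphic map `f` from the unit disc
to `D` satisfies `f ζ = z` and `f η = w`. -/
noncomputable def kobayashiDist {E : Type*} [NormedAddCommGroup E] [NormedSpace ℂ E]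
    (D : Set E) (z w : E) : ℝ :=
  sInf {r : ℝ | ∃ ζ ∈ Metric.ball (0 : ℂ) 1, ∃ η ∈ Metric.ball (0 : ℂ) 1, ∃ f : ℂ → E,
    DifferentiableOn ℂ f (Metric.ball 0 1) ∧ Set.MapsTo f (Metric.ball 0 1) D ∧
      f ζ = z ∧ f η = w ∧ r = hyperbolicDist ζ η}

/-! ### Horofunctions, Busemann points and the detour distance

All notions are for a space `M` with distance function `d` and basepoint `b`. -/

section Metric

variable {M : Type*} (d : M → M → ℝ) (b : M)

/-- The function `h_y(z) = d(z, y) - d(b, y)`. -/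
def internalFunction (y : M) : M → ℝ := fun z => d z y - d b y

/-- A horofunction is an element of the closure of `{h_y : y ∈ M}`, in the topology of pointwise
convergence on the space of all functions `M → ℝ`, which is not itself one of the `h_y`. -/
def IsHorofunction (h : M → ℝ) : Prop :=
  h ∈ closure (Set.range (internalFunction d b)) \ Set.range (internalFunction d b)

/-- Almost geodesic sequences. -/
def IsAlmostGeodesic (y : ℕ → M) : Prop :=
  Filter.Tendsto (fun n => d (y n) (y 0)) Filter.atTop Filter.atTop ∧
    ∀ ε : ℝ, 0 < ε → ∃ N : ℕ, ∀ m k : ℕ, N ≤ k → k ≤ m →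
      d (y m) (y k) + d (y k) (y 0) - d (y m) (y 0) < ε

/-- `h_{y n}` converges to `h` pointwise. -/
def ConvergesTo (y : ℕ → M) (h : M → ℝ) : Prop :=
  ∀ x, Filter.Tendsto (fun n => internalFunction d b (y n) x) Filter.atTop (nhds (h x))

/-- A Busemann point is a horofunction which is the limit of an almost geodesic sequence. -/
def IsBusemannPoint (h : M → ℝ) : Prop :=
  IsHorofunction d b h ∧ ∃ y : ℕ → M, IsAlmostGeodesic d y ∧ ConvergesTo d b y h

/-- The detour cost `H(h₁, h₂)`, the infimum of `liminf (d(b, z n) + h₂(z n))` over all sequences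
`z` such that `h_{z n}` converges to `h₁`. It may be infinite. -/
noncomputable def detourCost (h₁ h₂ : M → ℝ) : EReal :=
  ⨅ z : {z : ℕ → M // ConvergesTo d b z h₁},
    Filter.liminf (fun n => ((d b (z.1 n) + h₂ (z.1 n) : ℝ) : EReal)) Filter.atTop

/-- The detour distance `δ(h₁, h₂) = H(h₁, h₂) + H(h₂, h₁)`. -/
noncomputable def detourDist (h₁ h₂ : M → ℝ) : EReal :=
  detourCost d b h₁ h₂ + detourCost d b h₂ h₁

/-- The part of `h`: all Busemann points at finite detour distance from `h`. -/
def part (h : M → ℝ) : Set (M → ℝ) :=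
  {h' | IsBusemannPoint d b h' ∧ detourDist d b h h' < ⊤}

end Metric

/-! ### The variation norm -/

/-- The quotient `ℝ^ι / Sp(1)` of `ℝ^ι` by the line of constant vectors. -/
abbrev VarSpace (ι : Type*) : Type _ :=
  (ι → ℝ) ⧸ Submodule.span ℝ {(fun _ => 1 : ι → ℝ)}

theorem varNorm_aux {ι : Type*} [Finite ι] (x : ι → ℝ) (c : ℝ) :
    (⨆ j, (x j + c)) + (⨆ j, -(x j + c)) = (⨆ j, x j) + ⨆ j, -x j := by
  rcases isEmpty_or_nonempty ι with hι | hι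
  · simp [Real.iSup_of_isEmpty]
  · have h1 : (⨆ j, (x j + c)) = (⨆ j, x j) + c :=
      (ciSup_add (Set.finite_range x).bddAbove c).symm
    have h2 : (⨆ j, -(x j + c)) = (⨆ j, -x j) + -c := by
      rw [ciSup_add (Set.finite_range fun j => -x j).bddAbove]
      simp only [neg_add]
    rw [h1, h2]
    ring

/-- The variation norm `max_j x_j + max_j (-x_j)` of the class of `x` in `ℝ^ι / Sp(1)`. -/
noncomputable def varNorm {ι : Type*} [Finite ι] (v : VarSpace ι) : ℝ :=
  Quotient.liftOn' v (fun x => (⨆ j, x j) + ⨆ j, -x j) (by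
    intro x y hxy
    obtain ⟨c, hc⟩ := Submodule.mem_span_singleton.1 ((Submodule.quotientRel_def _).1 hxy)
    have hx : x = fun j => y j + c := by
      funext j
      have := congrFun hc j
      simp at this
      linarith
    subst hx
    exact varNorm_aux y c)

theorem varNorm_mk {ι : Type*} [Finite ι] (x : ι → ℝ) :
    varNorm (Submodule.Quotient.mk x : VarSpace ι) = (⨆ j, x j) + ⨆ j, -x j := rfl

/-! ### Products of Euclidean balls -/

/-- The product `B^{n_1} × ⋯ × B^{n_q}` of open Euclidean unit balls. -/
def ballProd {q : ℕ} (n : Fin q → ℕ) : Set ((j : Fin q) → EuclideanSpace ℂ (Fin (n j))) :=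
  {z | ∀ j, ‖z j‖ < 1}

/-- The origin of `B^{n_1} × ⋯ × B^{n_q}`. -/
def origin {q : ℕ} (n : Fin q → ℕ) : ballProd n := ⟨0, fun j => by simp⟩

/-- The Kobayashi distance on `B^{n_1} × ⋯ × B^{n_q}`. -/
noncomputable def kob {q : ℕ} (n : Fin q → ℕ) (z w : ballProd n) : ℝ :=
  kobayashiDist (ballProd n) (z : (j : Fin q) → EuclideanSpace ℂ (Fin (n j))) w

/-- The function `log (|1 - ⟨z, ξ⟩|² / (1 - ‖z‖²))`, where `⟨z, ξ⟩ = ∑ i, z i * conj (ξ i)`. -/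
noncomputable def ballHoro {m : ℕ} (ξ z : EuclideanSpace ℂ (Fin m)) : ℝ :=
  Real.log (‖1 - inner ℂ ξ z‖ ^ 2 / (1 - ‖z‖ ^ 2))

/-- The function `z ↦ max_{j ∈ J} (log (|1 - ⟨z_j, ξ_j⟩|² / (1 - ‖z_j‖²)) - α_j)`, for a nonempty
set of indices `J`. -/
noncomputable def prodHoro {q : ℕ} {n : Fin q → ℕ} {J : Finset (Fin q)} (hJ : J.Nonempty)
    (ξ : (j : J) → EuclideanSpace ℂ (Fin (n j))) (α : J → ℝ) : ballProd n → ℝ :=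
  fun z => J.attach.sup' hJ.attach fun j => ballHoro (ξ j) (z.1 j) - α j

end KobHoro

/-! Everything rests on an explicit distance. Two points of a ball lie in a complex line that meets
the ball in a disc, and the ball retracts holomorphically onto that disc, so Schwarz–Pick computes
the Kobayashi distance of the ball (`pseudoDist_map_le`, `exists_disc`). On the product it is the
maximum over the factors (`kob_eq`).

For one ball, `d(z, y) = ballDiff z y + d(0, y)`, where `ballDiff z` extends continuously to the
closed ball and equals `ballHoro ξ z` at a boundary point `ξ`. Hence `h_y(z) = max_j (ballDiff z_j
y_j - gap_j)` with `gap_j = d(b, y) - d(0, y_j) ≥ 0`. Along an ultrafilter each `y_j` converges in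
the closed ball and each gap converges in `[0, ∞]`. If all limits are interior, the limit is some
`h_η`. Otherwise `d(b, y) → ∞`, the indices with finite gap form `J`, and some gap is eventually
`0`, so `min α = 0` (`exists_tendsto_or_isHoroLimit`). Conversely, moving coordinate `j ∈ J` along
the radius to `ξ_j` at distance `t - α_j` from the origin gives a geodesic ray with these limits
(`exists_ray`), so every such function is a Busemann point.

For the detour cost, `d(b, y) + h'(y)` is constant, equal to `max_j (α_j - α'_j)`, on the ray
towards `h` when `J` and `ξ` agree. Conversely a bound `C` on this quantity, along any family
tending to `h`, forces `J' ⊆ J`, `ξ' = ξ` on `J'` and `α_j - α'_j ≤ C`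
(`IsHoroLimit.exists_mem_of_le`). So a part consists of all `α` with `J`, `ξ` fixed, `δ` is the
variation norm of the difference, and each class modulo constants has exactly one representative
with minimum `0`. -/

namespace KobHoro

open Filter Topology Metric Set
open scoped ComplexConjugate

/-! ### Möbius transformations and the Schwarz–Pick lemma -/

/-- The Möbius transformation of the unit disc that takes `a` to `0`. -/
noncomputable def mobius (a z : ℂ) : ℂ := (z - a) / (1 - conj a * z)

theorem one_sub_conj_mul_ne_zero {a z : ℂ} (ha : ‖a‖ < 1) (hz : ‖z‖ < 1) :
    1 - conj a * z ≠ 0 := by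
  intro h
  have h1 : ‖conj a * z‖ = 1 := by rw [← sub_eq_zero.1 h]; simp
  rw [norm_mul, RCLike.norm_conj] at h1
  nlinarith [norm_nonneg a, norm_nonneg z]

theorem one_sub_norm_mobius_sq {a z : ℂ} (ha : ‖a‖ < 1) (hz : ‖z‖ < 1) :
    1 - ‖mobius a z‖ ^ 2 = (1 - ‖a‖ ^ 2) * (1 - ‖z‖ ^ 2) / ‖1 - conj a * z‖ ^ 2 := by
  have h : ‖1 - conj a * z‖ ^ 2 ≠ 0 := by
    simpa using one_sub_conj_mul_ne_zero ha hz
  rw [mobius, norm_div, div_pow, eq_div_iff h, sub_mul, div_mul_cancel₀ _ h]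
  simp only [Complex.sq_norm, Complex.normSq_apply, Complex.sub_re, Complex.sub_im, Complex.mul_re,
    Complex.mul_im, Complex.conj_re, Complex.conj_im, Complex.one_re, Complex.one_im]
  ring

theorem norm_mobius_lt_one {a z : ℂ} (ha : ‖a‖ < 1) (hz : ‖z‖ < 1) : ‖mobius a z‖ < 1 := by
  have h : 0 < ‖1 - conj a * z‖ := norm_pos_iff.2 (one_sub_conj_mul_ne_zero ha hz)
  have h1 : 0 < 1 - ‖a‖ ^ 2 := by nlinarith [norm_nonneg a]
  have h2 : 0 < 1 - ‖z‖ ^ 2 := by nlinarith [norm_nonneg z]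
  have h3 : 0 < 1 - ‖mobius a z‖ ^ 2 := by rw [one_sub_norm_mobius_sq ha hz]; positivity
  nlinarith [norm_nonneg (mobius a z)]

@[simp] theorem mobius_self (a : ℂ) : mobius a a = 0 := by simp [mobius]

@[simp] theorem mobius_zero (a : ℂ) : mobius a 0 = -a := by simp [mobius]

theorem mobius_neg_mobius {a z : ℂ} (ha : ‖a‖ < 1) (hz : ‖z‖ < 1) :
    mobius (-a) (mobius a z) = z := by
  have h : mobius a z * (1 - conj a * z) = z - a :=
    div_mul_cancel₀ _ (one_sub_conj_mul_ne_zero ha hz)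
  have h2 := one_sub_conj_mul_ne_zero (a := -a) (by simpa using ha) (norm_mobius_lt_one ha hz)
  rw [mobius, div_eq_iff h2, map_neg]
  linear_combination h

theorem differentiableOn_mobius {a : ℂ} (ha : ‖a‖ < 1) :
    DifferentiableOn ℂ (mobius a) (ball 0 1) := by
  intro z hz
  refine DifferentiableAt.differentiableWithinAt ?_
  unfold mobius
  exact DifferentiableAt.div (by fun_prop) (by fun_prop)
    (one_sub_conj_mul_ne_zero ha (by simpa using hz))

theorem mapsTo_mobius {a : ℂ} (ha : ‖a‖ < 1) : MapsTo (mobius a) (ball 0 1) (ball 0 1) :=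
  fun z hz => by simpa using norm_mobius_lt_one ha (by simpa using hz)

/-- The **Schwarz–Pick lemma**. -/
theorem norm_mobius_map_le {f : ℂ → ℂ} (hd : DifferentiableOn ℂ f (ball 0 1))
    (hm : MapsTo f (ball 0 1) (ball 0 1)) {a z : ℂ} (ha : ‖a‖ < 1) (hz : ‖z‖ < 1) :
    ‖mobius (f a) (f z)‖ ≤ ‖mobius a z‖ := by
  have hfa : ‖f a‖ < 1 := by simpa using hm (by simpa using ha : a ∈ ball (0 : ℂ) 1)
  have hna : ‖-a‖ < 1 := by simpa using ha
  have hd1 : DifferentiableOn ℂ (fun x => f (mobius (-a) x)) (ball 0 1) :=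
    hd.comp (differentiableOn_mobius hna) (mapsTo_mobius hna)
  have hm1 : MapsTo (fun x => f (mobius (-a) x)) (ball 0 1) (ball 0 1) :=
    hm.comp (mapsTo_mobius hna)
  -- Möbius maps on both sides move `a` and `f a` to `0`, where the Schwarz lemma applies.
  have key := Complex.norm_le_norm_of_mapsTo_ball
    (f := fun x => mobius (f a) (f (mobius (-a) x))) (R := 1) (z := mobius a z)
    ((differentiableOn_mobius hfa).comp hd1 hm1)
    (((mapsTo_mobius hfa).comp hm1).mono_right ball_subset_closedBall) (by simp)
    (norm_mobius_lt_one ha hz)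
  rwa [mobius_neg_mobius ha hz] at key

/-- The hyperbolic distance from `0` to a point of modulus `m`. -/
noncomputable def radialDist (m : ℝ) : ℝ := Real.log ((1 + m) / (1 - m))

theorem hyperbolicDist_eq (z w : ℂ) : hyperbolicDist z w = radialDist ‖mobius z w‖ := rfl

theorem radialDist_mono {s t : ℝ} (hs : 0 ≤ s) (hst : s ≤ t) (ht : t < 1) :
    radialDist s ≤ radialDist t := by
  refine Real.log_le_log (div_pos (by linarith) (by linarith)) ?_
  exact div_le_div₀ (by linarith) (by linarith) (by linarith) (by linarith)

@[simp] theorem radialDist_zero : radialDist 0 = 0 := by simp [radialDist]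

theorem radialDist_nonneg {t : ℝ} (h0 : 0 ≤ t) (ht : t < 1) : 0 ≤ radialDist t := by
  simpa using radialDist_mono le_rfl h0 ht

theorem hyperbolicDist_nonneg {z w : ℂ} (hz : ‖z‖ < 1) (hw : ‖w‖ < 1) :
    0 ≤ hyperbolicDist z w :=
  radialDist_nonneg (norm_nonneg _) (norm_mobius_lt_one hz hw)

/-! ### Complex lines in the unit ball -/

section Ball

variable {E : Type*} [NormedAddCommGroup E] [InnerProductSpace ℂ E]

/-- The quantity `1 - m²`, where `m` is the pseudo-hyperbolic distance in the unit ball. -/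
noncomputable def ballRatio (z w : E) : ℝ :=
  (1 - ‖z‖ ^ 2) * (1 - ‖w‖ ^ 2) / ‖1 - inner ℂ w z‖ ^ 2

/-- The pseudo-hyperbolic distance in the unit ball. -/
noncomputable def pseudoDist (z w : E) : ℝ := √(1 - ballRatio z w)

/-- The explicit formula for the Kobayashi distance of the unit ball. -/
noncomputable def ballDist (z w : E) : ℝ := radialDist (pseudoDist z w)

theorem norm_inner_lt_one {z w : E} (hz : ‖z‖ < 1) (hw : ‖w‖ ≤ 1) : ‖inner ℂ w z‖ < 1 := by
  have h := norm_inner_le_norm (𝕜 := ℂ) w z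
  nlinarith [norm_nonneg z, norm_nonneg w]

theorem one_sub_inner_ne_zero {z w : E} (hz : ‖z‖ < 1) (hw : ‖w‖ ≤ 1) :
    (1 : ℂ) - inner ℂ w z ≠ 0 := by
  intro h
  have h1 : ‖(inner ℂ w z : ℂ)‖ = 1 := by rw [← sub_eq_zero.1 h]; simp
  exact (norm_inner_lt_one hz hw).ne h1

theorem ballRatio_pos {z w : E} (hz : ‖z‖ < 1) (hw : ‖w‖ < 1) : 0 < ballRatio z w := by
  have h : 0 < ‖(1 : ℂ) - inner ℂ w z‖ := norm_pos_iff.2 (one_sub_inner_ne_zero hz hw.le)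
  have h1 : 0 < 1 - ‖z‖ ^ 2 := by nlinarith [norm_nonneg z]
  have h2 : 0 < 1 - ‖w‖ ^ 2 := by nlinarith [norm_nonneg w]
  unfold ballRatio; positivity

theorem pseudoDist_nonneg (z w : E) : 0 ≤ pseudoDist z w := Real.sqrt_nonneg _

theorem pseudoDist_lt_one {z w : E} (hz : ‖z‖ < 1) (hw : ‖w‖ < 1) : pseudoDist z w < 1 := by
  rw [pseudoDist, Real.sqrt_lt' one_pos]
  linarith [ballRatio_pos hz hw]

theorem ballDist_nonneg {z w : E} (hz : ‖z‖ < 1) (hw : ‖w‖ < 1) : 0 ≤ ballDist z w :=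
  radialDist_nonneg (pseudoDist_nonneg z w) (pseudoDist_lt_one hz hw)

theorem pseudoDist_self {z : E} (hz : ‖z‖ < 1) : pseudoDist z z = 0 := by
  have h : 0 < 1 - ‖z‖ ^ 2 := by nlinarith [norm_nonneg z]
  have h1 : (1 : ℂ) - inner ℂ z z = ((1 - ‖z‖ ^ 2 : ℝ) : ℂ) := by
    rw [inner_self_eq_norm_sq_to_K]; push_cast; rfl
  rw [pseudoDist, ballRatio, h1, Complex.norm_real, Real.norm_of_nonneg h.le, ← sq,
    div_self (by positivity)]
  simp

/-- `u` spans the direction of a complex line that meets the unit ball in a disc of centre `c` and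
radius `r`. -/
structure IsSlice (c u : E) (r : ℝ) : Prop where
  pos : 0 < r
  sq_eq : r ^ 2 = 1 - ‖c‖ ^ 2
  norm_eq : ‖u‖ = 1
  inner_eq : inner ℂ u c = (0 : ℂ)

theorem IsSlice.inner_point {c u : E} {r : ℝ} (h : IsSlice c u r) (a b : ℂ) :
    inner ℂ (c + (r * a) • u) (c + (r * b) • u) = ((‖c‖ ^ 2 : ℝ) : ℂ) + r ^ 2 * (conj a * b) := by
  have h1 : inner ℂ c u = (0 : ℂ) := by rw [← inner_conj_symm, h.inner_eq, map_zero]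
  have h2 : inner ℂ u u = (1 : ℂ) := by rw [inner_self_eq_norm_sq_to_K, h.norm_eq]; simp
  have h3 : inner ℂ c c = ((‖c‖ ^ 2 : ℝ) : ℂ) := by
    rw [inner_self_eq_norm_sq_to_K]; push_cast; rfl
  simp only [inner_add_left, inner_add_right, inner_smul_left, inner_smul_right, h1, h2, h3,
    h.inner_eq, map_mul, Complex.conj_ofReal]
  ring

theorem IsSlice.norm_point_sq {c u : E} {r : ℝ} (h : IsSlice c u r) (a : ℂ) :
    ‖c + (r * a) • u‖ ^ 2 = ‖c‖ ^ 2 + r ^ 2 * ‖a‖ ^ 2 := by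
  have h1 := h.inner_point a a
  rw [inner_self_eq_norm_sq_to_K, Complex.conj_mul'] at h1
  apply Complex.ofReal_injective
  push_cast at h1 ⊢
  exact h1

theorem IsSlice.norm_point_lt_one_iff {c u : E} {r : ℝ} (h : IsSlice c u r) (a : ℂ) :
    ‖c + (r * a) • u‖ < 1 ↔ ‖a‖ < 1 := by
  have h1 := h.norm_point_sq a
  have h2 := h.sq_eq
  have h3 : 0 < r ^ 2 := pow_pos h.pos 2
  rw [← sq_lt_one_iff₀ (norm_nonneg _), ← sq_lt_one_iff₀ (norm_nonneg a), h1]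
  constructor <;> intro h4 <;> nlinarith

/-- Since `‖c‖² = 1 - r²`, every factor of `ballRatio` restricts to `r²` times its analogue in the
disc, and the powers of `r` cancel. -/
theorem IsSlice.pseudoDist_point {c u : E} {r : ℝ} (h : IsSlice c u r) {a b : ℂ} (ha : ‖a‖ < 1)
    (hb : ‖b‖ < 1) : pseudoDist (c + (r * a) • u) (c + (r * b) • u) = ‖mobius a b‖ := by
  have h1 := h.sq_eq
  have hr := h.pos
  have h2 : (1 : ℂ) - inner ℂ (c + (r * b) • u) (c + (r * a) • u)
      = ((r ^ 2 : ℝ) : ℂ) * conj (1 - conj a * b) := by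
    rw [h.inner_point, h1]
    simp only [map_sub, map_mul, map_one, Complex.conj_conj]
    have : (r : ℂ) ^ 2 = 1 - ((‖c‖ ^ 2 : ℝ) : ℂ) := by exact_mod_cast congrArg Complex.ofReal h1
    rw [this]; push_cast; ring
  have h3 : 0 < ‖1 - conj a * b‖ := norm_pos_iff.2 (one_sub_conj_mul_ne_zero ha hb)
  have h4 : ballRatio (c + (r * a) • u) (c + (r * b) • u) = 1 - ‖mobius a b‖ ^ 2 := by
    rw [one_sub_norm_mobius_sq ha hb, ballRatio, h2, norm_mul, RCLike.norm_conj, Complex.norm_real,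
      Real.norm_of_nonneg (by positivity), h.norm_point_sq, h.norm_point_sq,
      div_eq_div_iff (by positivity) (by positivity)]
    have h5 : ‖c‖ ^ 2 = 1 - r ^ 2 := by linarith
    rw [h5]; ring
  rw [pseudoDist, h4, sub_sub_cancel, Real.sqrt_sq (norm_nonneg _)]

/-- The centre `c` is the foot of the perpendicular from the origin to the line through `z` and `w`;
it is no longer than `z`, so the radius is positive. -/
theorem exists_isSlice {z w : E} (hz : ‖z‖ < 1) (hw : ‖w‖ < 1) (hzw : z ≠ w) :
    ∃ (c u : E) (r : ℝ) (a b : ℂ), IsSlice c u r ∧ z = c + (r * a) • u ∧ w = c + (r * b) • u ∧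
      ‖a‖ < 1 ∧ ‖b‖ < 1 := by
  have hne : ‖z - w‖ ≠ 0 := by simpa [sub_eq_zero] using hzw
  set u : E := ((‖z - w‖⁻¹ : ℝ) : ℂ) • (z - w) with hu
  have hu1 : ‖u‖ = 1 := by
    rw [hu, norm_smul, Complex.norm_real, norm_inv, norm_norm, inv_mul_cancel₀ hne]
  have huu : inner ℂ u u = (1 : ℂ) := by rw [inner_self_eq_norm_sq_to_K, hu1]; simp
  have hzwu : z - w = ((‖z - w‖ : ℝ) : ℂ) • u := by
    rw [hu, smul_smul, ← Complex.ofReal_mul, mul_inv_cancel₀ hne]; simp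
  set c : E := z - (inner ℂ u z : ℂ) • u with hc
  have huc : inner ℂ u c = (0 : ℂ) := by
    rw [hc, inner_sub_right, inner_smul_right, huu]; ring
  have hcz : ‖c‖ ≤ ‖z‖ := by
    have h1 : ‖z‖ * ‖z‖ = ‖(inner ℂ u z : ℂ) • u‖ * ‖(inner ℂ u z : ℂ) • u‖ + ‖c‖ * ‖c‖ := by
      rw [← norm_add_sq_eq_norm_sq_add_norm_sq_of_inner_eq_zero (𝕜 := ℂ) _ _
        (by rw [inner_smul_left, huc, mul_zero]), hc]
      congr 2 <;> simp
    nlinarith [norm_nonneg c, norm_nonneg z, mul_self_nonneg ‖(inner ℂ u z : ℂ) • u‖]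
  have hc1 : 0 < 1 - ‖c‖ ^ 2 := by nlinarith [norm_nonneg c]
  have hr : 0 < √(1 - ‖c‖ ^ 2) := Real.sqrt_pos.2 hc1
  have hr' : ((√(1 - ‖c‖ ^ 2) : ℝ) : ℂ) ≠ 0 := by exact_mod_cast hr.ne'
  have hs : IsSlice c u (√(1 - ‖c‖ ^ 2)) := ⟨hr, Real.sq_sqrt hc1.le, hu1, huc⟩
  set r := √(1 - ‖c‖ ^ 2)
  have hz' : z = c + (r * ((inner ℂ u z : ℂ) / r)) • u := by
    rw [mul_div_cancel₀ _ hr', hc]; simp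
  have hw' : w = c + (r * (((inner ℂ u z : ℂ) - ((‖z - w‖ : ℝ) : ℂ)) / r)) • u := by
    rw [mul_div_cancel₀ _ hr', sub_smul, ← hzwu, hc]; abel
  refine ⟨c, u, r, _, _, hs, hz', hw', ?_, ?_⟩
  · rwa [← hs.norm_point_lt_one_iff, ← hz']
  · rwa [← hs.norm_point_lt_one_iff, ← hw']

/-- A holomorphic retraction of the unit ball onto a slice, in the coordinate of the slice. -/
noncomputable def sliceRetract (c u : E) (r : ℝ) (x : E) : ℂ :=
  r * inner ℂ u x / (1 - inner ℂ c x)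

theorem IsSlice.norm_center_lt_one {c u : E} {r : ℝ} (h : IsSlice c u r) : ‖c‖ < 1 := by
  have h1 := h.sq_eq
  have h2 := pow_pos h.pos 2
  nlinarith [norm_nonneg c]

theorem IsSlice.sliceRetract_point {c u : E} {r : ℝ} (h : IsSlice c u r) (a : ℂ) :
    sliceRetract c u r (c + (r * a) • u) = a := by
  have h1 : inner ℂ c u = (0 : ℂ) := by rw [← inner_conj_symm, h.inner_eq, map_zero]
  have h2 : inner ℂ u u = (1 : ℂ) := by rw [inner_self_eq_norm_sq_to_K, h.norm_eq]; simp
  have h3 : inner ℂ c c = ((‖c‖ ^ 2 : ℝ) : ℂ) := by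
    rw [inner_self_eq_norm_sq_to_K]; push_cast; rfl
  have h4 : (1 : ℂ) - ((‖c‖ ^ 2 : ℝ) : ℂ) = (r : ℂ) ^ 2 := by
    have := congrArg Complex.ofReal h.sq_eq
    push_cast at this ⊢
    exact this.symm
  have h5 : (r : ℂ) ≠ 0 := by exact_mod_cast h.pos.ne'
  simp only [sliceRetract, inner_add_right, inner_smul_right, h1, h2, h3, h.inner_eq, mul_zero,
    add_zero, h4]
  field_simp
  ring

/-- Write `x = p u + y` with `y ⊥ u`. Then `r²|p|² < (1 - ‖c‖²)(1 - ‖y‖²) = (1 - ‖c‖‖y‖)² - (‖c‖ -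
‖y‖)²`, and `1 - ‖c‖‖y‖` bounds the denominator from below. -/
theorem IsSlice.norm_sliceRetract_lt_one {c u : E} {r : ℝ} (h : IsSlice c u r) {x : E}
    (hx : ‖x‖ < 1) : ‖sliceRetract c u r x‖ < 1 := by
  have hcu : inner ℂ c u = (0 : ℂ) := by rw [← inner_conj_symm, h.inner_eq, map_zero]
  have huu : inner ℂ u u = (1 : ℂ) := by rw [inner_self_eq_norm_sq_to_K, h.norm_eq]; simp
  set p : ℂ := inner ℂ u x with hp
  set y : E := x - p • u with hy
  have huy : inner ℂ u y = (0 : ℂ) := by rw [hy, inner_sub_right, inner_smul_right, huu, ← hp]; ring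
  have h1 : ‖x‖ * ‖x‖ = ‖p • u‖ * ‖p • u‖ + ‖y‖ * ‖y‖ := by
    rw [← norm_add_sq_eq_norm_sq_add_norm_sq_of_inner_eq_zero (𝕜 := ℂ) _ _
      (by rw [inner_smul_left, huy, mul_zero]), hy]
    congr 2 <;> simp
  rw [norm_smul, h.norm_eq, mul_one] at h1
  have h2 : (inner ℂ c x : ℂ) = inner ℂ c y := by
    rw [hy, inner_sub_right, inner_smul_right, hcu]; ring
  have h3 : ‖(inner ℂ c x : ℂ)‖ ≤ ‖c‖ * ‖y‖ := h2 ▸ norm_inner_le_norm c y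
  have h4 : 1 - ‖(inner ℂ c x : ℂ)‖ ≤ ‖1 - (inner ℂ c x : ℂ)‖ := by
    simpa using norm_sub_norm_le (1 : ℂ) (inner ℂ c x)
  have hc := h.norm_center_lt_one
  have hy1 : ‖y‖ < 1 := by nlinarith [norm_nonneg x, norm_nonneg y, mul_self_nonneg ‖p‖]
  have h5 : 0 < 1 - ‖c‖ * ‖y‖ := by nlinarith [norm_nonneg c, norm_nonneg y]
  have h6 : (r * ‖p‖) ^ 2 < (1 - ‖c‖ * ‖y‖) ^ 2 := by
    have h8 : ‖p‖ ^ 2 < 1 - ‖y‖ ^ 2 := by nlinarith [norm_nonneg x]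
    rw [mul_pow]
    have h9 := mul_lt_mul_of_pos_left h8 (pow_pos h.pos 2)
    rw [h.sq_eq] at h9 ⊢
    nlinarith [sq_nonneg (‖c‖ - ‖y‖)]
  have h7 : r * ‖p‖ < 1 - ‖c‖ * ‖y‖ := lt_of_pow_lt_pow_left₀ 2 h5.le h6
  rw [sliceRetract, norm_div, norm_mul, Complex.norm_real, Real.norm_of_nonneg h.pos.le,
    div_lt_one (by linarith)]
  linarith

theorem IsSlice.differentiableOn_sliceRetract {c u : E} {r : ℝ} (h : IsSlice c u r) :
    DifferentiableOn ℂ (sliceRetract c u r) (ball 0 1) := by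
  intro x hx
  refine DifferentiableAt.differentiableWithinAt ?_
  have h1 : ∀ v : E, DifferentiableAt ℂ (fun x : E => (inner ℂ v x : ℂ)) x :=
    fun v => (innerSL ℂ v).differentiableAt
  have h2 : DifferentiableAt ℂ (fun x : E => (1 - inner ℂ c x : ℂ)⁻¹) x :=
    (differentiableAt_inv (one_sub_inner_ne_zero (by simpa using hx) h.norm_center_lt_one.le)).comp
      x ((h1 c).const_sub 1)
  exact ((h1 u).const_mul (r : ℂ)).mul h2

/-- Holomorphic maps from the disc to the ball do not increase pseudo-hyperbolic distances. -/
theorem pseudoDist_map_le {f : ℂ → E} (hd : DifferentiableOn ℂ f (ball 0 1))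
    (hm : MapsTo f (ball 0 1) (ball 0 1)) {a b : ℂ} (ha : ‖a‖ < 1) (hb : ‖b‖ < 1) :
    pseudoDist (f a) (f b) ≤ ‖mobius a b‖ := by
  have hfa : ‖f a‖ < 1 := by simpa using hm (by simpa using ha : a ∈ ball (0 : ℂ) 1)
  have hfb : ‖f b‖ < 1 := by simpa using hm (by simpa using hb : b ∈ ball (0 : ℂ) 1)
  by_cases hab : f a = f b
  · rw [hab, pseudoDist_self hfb]; exact norm_nonneg _
  obtain ⟨c, u, r, α, β, hs, h1, h2, hα, hβ⟩ := exists_isSlice hfa hfb hab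
  -- Retracting onto the slice through `f a` and `f b` gives a self-map of the disc that takes `a`,
  -- `b` to the slice coordinates of these points.
  have key := norm_mobius_map_le (f := fun x => sliceRetract c u r (f x))
    (hs.differentiableOn_sliceRetract.comp hd hm)
    (fun x hx => by
      simpa using hs.norm_sliceRetract_lt_one (by simpa using hm hx)) ha hb
  simp only [h1, h2, hs.sliceRetract_point] at key
  rw [h1, h2, hs.pseudoDist_point hα hβ]
  exact key

/-- Any two points of the ball lie on a holomorphic disc that realizes a given larger
pseudo-hyperbolic distance. -/
theorem exists_disc {z w : E} (hz : ‖z‖ < 1) (hw : ‖w‖ < 1) {t : ℝ} (ht : pseudoDist z w ≤ t) :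
    ∃ f : ℂ → E, DifferentiableOn ℂ f (ball 0 1) ∧ MapsTo f (ball 0 1) (ball 0 1) ∧
      f 0 = z ∧ f t = w := by
  by_cases hzw : z = w
  · exact ⟨fun _ => z, differentiableOn_const _, fun _ _ => by simpa using hz, rfl, hzw⟩
  obtain ⟨c, u, r, a, b, hs, h1, h2, ha, hb⟩ := exists_isSlice hz hw hzw
  rw [h1, h2, hs.pseudoDist_point ha hb] at ht
  have hna : ‖-a‖ < 1 := by simpa using ha
  have ht0 : 0 ≤ t := (norm_nonneg _).trans ht
  have hk : ‖mobius a b / t‖ ≤ 1 := by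
    rw [norm_div, Complex.norm_real, Real.norm_of_nonneg ht0]
    exact div_le_one_of_le₀ ht ht0
  -- The factor `mobius a b / t` rotates and shrinks the parameter so that `t` goes to `mobius a b`.
  -- For `t = 0` the quotient is `0` by convention, and `mobius a b` vanishes too.
  have hk' : mobius a b / t * t = mobius a b := by
    rcases ht0.eq_or_lt with h | h
    · have : mobius a b = 0 := norm_le_zero_iff.1 (h ▸ ht)
      simp [this]
    · exact div_mul_cancel₀ _ (by exact_mod_cast h.ne')
  have hm : MapsTo (fun x => mobius a b / t * x) (ball 0 1) (ball 0 1) := by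
    intro x hx
    simp only [mem_ball_zero_iff] at hx ⊢
    rw [norm_mul]
    nlinarith [norm_nonneg x]
  refine ⟨fun x => c + (r * mobius (-a) (mobius a b / t * x)) • u, ?_, ?_, ?_, ?_⟩
  · have := (differentiableOn_mobius hna).comp
      (f := fun x => mobius a b / t * x) (by fun_prop) hm
    exact (differentiableOn_const _).add ((this.const_mul _).smul_const u)
  · intro x hx
    rw [mem_ball_zero_iff, hs.norm_point_lt_one_iff]
    exact norm_mobius_lt_one hna (by simpa using hm hx)
  · simp [h1]
  · simp only [hk', mobius_neg_mobius ha hb, h2]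

end Ball

/-! ### The Kobayashi distance of a product of balls -/

theorem exists_ciSup_eq_or_isEmpty {ι : Type*} [Finite ι] (F : ι → ℝ) :
    (IsEmpty ι ∧ ⨆ i, F i = 0) ∨ ∃ i, F i = ⨆ i, F i := by
  rcases isEmpty_or_nonempty ι with h | h
  · exact Or.inl ⟨h, Real.iSup_of_isEmpty _⟩
  · exact Or.inr exists_eq_ciSup_of_finite

/-- With `t` the largest pseudo-hyperbolic distance, all factors have discs taking `0`, `t` to the
given points, and these combine into one disc in the product. Conversely each coordinate of a disc
in the product is a disc in a ball. -/
theorem kob_eq {q : ℕ} (n : Fin q → ℕ) (z w : ballProd n) :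
    kob n z w = ⨆ j, ballDist (z.1 j) (w.1 j) := by
  have hz := z.2
  have hw := w.2
  obtain ⟨t, ht0, ht1, ht, htd⟩ : ∃ t : ℝ, 0 ≤ t ∧ t < 1 ∧
      (∀ j, pseudoDist (z.1 j) (w.1 j) ≤ t) ∧ radialDist t = ⨆ j, ballDist (z.1 j) (w.1 j) := by
    rcases exists_ciSup_eq_or_isEmpty (fun j => pseudoDist (z.1 j) (w.1 j)) with ⟨h, -⟩ | ⟨i, hi⟩
    -- For `q = 0` the supremum takes its default value `0`, the distance of a one-point space.
    · exact ⟨0, le_rfl, one_pos, fun j => h.elim j, by rw [Real.iSup_of_isEmpty, radialDist_zero]⟩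
    · have hle : ∀ j, pseudoDist (z.1 j) (w.1 j) ≤ pseudoDist (z.1 i) (w.1 i) := fun j =>
        hi ▸ le_ciSup (f := fun j => pseudoDist (z.1 j) (w.1 j)) (Set.finite_range _).bddAbove j
      refine ⟨_, pseudoDist_nonneg (z.1 i) (w.1 i), pseudoDist_lt_one (hz i) (hw i), hle, ?_⟩
      have : Nonempty (Fin q) := ⟨i⟩
      refine le_antisymm (le_ciSup (f := fun j => ballDist (z.1 j) (w.1 j))
        (Set.finite_range _).bddAbove i) (ciSup_le fun j => ?_)
      exact radialDist_mono (pseudoDist_nonneg _ _) (hle j) (pseudoDist_lt_one (hz i) (hw i))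
  have hmem : ∃ ζ ∈ ball (0 : ℂ) 1, ∃ η ∈ ball (0 : ℂ) 1,
      ∃ f : ℂ → ((j : Fin q) → EuclideanSpace ℂ (Fin (n j))),
      DifferentiableOn ℂ f (ball 0 1) ∧ MapsTo f (ball 0 1) (ballProd n) ∧
        f ζ = z.1 ∧ f η = w.1 ∧ radialDist t = hyperbolicDist ζ η := by
    choose f hd hm h0 h1 using fun j => exists_disc (hz j) (hw j) (ht j)
    refine ⟨0, by simp, t, by simpa [abs_of_nonneg ht0] using ht1, fun x j => f j x, ?_, ?_,
      funext h0, funext h1, ?_⟩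
    · exact differentiableOn_pi.2 hd
    · intro x hx j
      simpa using hm j hx
    · rw [hyperbolicDist_eq]; simp [mobius, abs_of_nonneg ht0]
  rw [kob, kobayashiDist, ← htd]
  refine le_antisymm (csInf_le ⟨0, ?_⟩ hmem) (le_csInf ⟨_, hmem⟩ ?_)
  · rintro _ ⟨ζ, hζ, η, hη, -, -, -, -, -, rfl⟩
    exact hyperbolicDist_nonneg (by simpa using hζ) (by simpa using hη)
  · rintro _ ⟨ζ, hζ, η, hη, f, hd, hm, h1, h2, rfl⟩
    rw [mem_ball_zero_iff] at hζ hη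
    rw [htd]
    refine Real.iSup_le (fun j => ?_) (hyperbolicDist_nonneg hζ hη)
    rw [← h1, ← h2, ballDist, hyperbolicDist_eq]
    refine radialDist_mono (pseudoDist_nonneg _ _) ?_ (norm_mobius_lt_one hζ hη)
    exact pseudoDist_map_le (f := fun x => f x j) (differentiableOn_pi.1 hd j)
      (fun x hx => by simpa using hm hx j) hζ hη

/-! ### Boundary behaviour of the distance of the ball -/

theorem one_sub_norm_sq_pos {E : Type*} [SeminormedAddCommGroup E] {z : E} (hz : ‖z‖ < 1) :
    0 < 1 - ‖z‖ ^ 2 := by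
  nlinarith [norm_nonneg z]

section Boundary

variable {E : Type*} [NormedAddCommGroup E] [InnerProductSpace ℂ E]

/-- A continuous extension to the closed ball, in the variable `y`, of the difference
`ballDist z y - ballDist 0 y`. -/
noncomputable def ballDiff (z y : E) : ℝ :=
  2 * Real.log (1 + pseudoDist z y) - 2 * Real.log (1 + ‖y‖) +
    Real.log (‖1 - inner ℂ y z‖ ^ 2 / (1 - ‖z‖ ^ 2))

theorem radialDist_eq {m : ℝ} (h0 : 0 ≤ m) (h1 : m < 1) :
    radialDist m = 2 * Real.log (1 + m) - Real.log (1 - m ^ 2) := by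
  have h2 : 1 - m ^ 2 = (1 - m) * (1 + m) := by ring
  rw [radialDist, Real.log_div (by linarith) (by linarith), h2,
    Real.log_mul (by linarith) (by linarith)]
  ring

theorem pseudoDist_zero_left {y : E} : pseudoDist 0 y = ‖y‖ := by
  rw [pseudoDist, ballRatio]
  simp

theorem ballDist_zero_left (y : E) : ballDist 0 y = radialDist ‖y‖ := by
  rw [ballDist, pseudoDist_zero_left]

/-- `Real.sqrt` vanishes on negative numbers, so this bound is what gives `pseudoDist ^ 2 = 1 -
ballRatio`. -/
theorem ballRatio_le_one {z w : E} (hz : ‖z‖ < 1) (hw : ‖w‖ < 1) : ballRatio z w ≤ 1 := by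
  by_cases h : z = w
  · subst h
    have h1 : 0 < 1 - ‖z‖ ^ 2 := one_sub_norm_sq_pos hz
    have h2 : (1 : ℂ) - inner ℂ z z = ((1 - ‖z‖ ^ 2 : ℝ) : ℂ) := by
      rw [inner_self_eq_norm_sq_to_K]; push_cast; rfl
    rw [ballRatio, h2, Complex.norm_real, Real.norm_of_nonneg h1.le, ← sq,
      div_self (by positivity)]
  · have h1 : ‖1 - ‖z‖ * ‖w‖‖ ≤ ‖(1 : ℂ) - inner ℂ w z‖ := by
      have h2 := norm_inner_le_norm (𝕜 := ℂ) w z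
      have h3 : 1 - ‖(inner ℂ w z : ℂ)‖ ≤ ‖1 - (inner ℂ w z : ℂ)‖ := by
        simpa using norm_sub_norm_le (1 : ℂ) (inner ℂ w z)
      rw [Real.norm_of_nonneg (by nlinarith [norm_nonneg z, norm_nonneg w])]
      linarith [mul_comm ‖w‖ ‖z‖]
    have h4 : 0 < ‖(1 : ℂ) - inner ℂ w z‖ := norm_pos_iff.2 (one_sub_inner_ne_zero hz hw.le)
    rw [ballRatio, div_le_one (by positivity)]
    have h5 := pow_le_pow_left₀ (norm_nonneg _) h1 2
    rw [Real.norm_eq_abs, sq_abs] at h5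
    nlinarith [sq_nonneg (‖z‖ - ‖w‖)]

/-- The term `log (1 - ‖y‖²)`, the only one singular as `‖y‖ → 1`, occurs in both distances and
cancels. -/
theorem ballDist_eq_add {z y : E} (hz : ‖z‖ < 1) (hy : ‖y‖ < 1) :
    ballDist z y = ballDiff z y + radialDist ‖y‖ := by
  have h1 := one_sub_norm_sq_pos hz
  have h2 := one_sub_norm_sq_pos hy
  have h3 : 0 < ‖(1 : ℂ) - inner ℂ y z‖ := norm_pos_iff.2 (one_sub_inner_ne_zero hz hy.le)
  have h4 : 1 - pseudoDist z y ^ 2 = ballRatio z y := by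
    rw [pseudoDist, Real.sq_sqrt (by linarith [ballRatio_le_one hz hy])]; ring
  rw [ballDist, radialDist_eq (pseudoDist_nonneg z y) (pseudoDist_lt_one hz hy),
    radialDist_eq (norm_nonneg y) hy, h4, ballDiff, ballRatio,
    Real.log_div (by positivity) (by positivity), Real.log_div (by positivity) (by positivity),
    Real.log_mul (by positivity) (by positivity)]
  ring

theorem continuousAt_ballDiff {z y : E} (hz : ‖z‖ < 1) (hy : ‖y‖ ≤ 1) :
    ContinuousAt (ballDiff z) y := by
  have h0 := one_sub_inner_ne_zero hz hy
  have h1 := one_sub_norm_sq_pos hz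
  have h2 : ContinuousAt (fun y => (1 : ℂ) - inner ℂ y z) y := by fun_prop
  have h3 : ‖(1 : ℂ) - inner ℂ y z‖ ^ 2 ≠ 0 := pow_ne_zero _ (norm_ne_zero_iff.2 h0)
  have h4 : ContinuousAt (fun y => ‖(1 : ℂ) - inner ℂ y z‖ ^ 2) y := h2.norm.pow 2
  have h5 : ContinuousAt (pseudoDist z) y := by
    unfold pseudoDist ballRatio
    exact (ContinuousAt.sub continuousAt_const
      (ContinuousAt.div (by fun_prop) h4 h3)).sqrt
  refine ContinuousAt.add (ContinuousAt.sub ?_ ?_) ?_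
  · exact ((continuousAt_const.add h5).log
      (add_pos_of_pos_of_nonneg one_pos (pseudoDist_nonneg z y)).ne').const_mul 2
  · exact ((continuousAt_const.add continuousAt_id.norm).log
      (add_pos_of_pos_of_nonneg one_pos (norm_nonneg y)).ne').const_mul 2
  · exact (h4.div_const _).log (div_ne_zero h3 h1.ne')

/-- The bound is uniform in `y`, so a coordinate whose gap tends to infinity drops out of the
maximum. -/
theorem ballDiff_le {z y : E} (hz : ‖z‖ < 1) (hy : ‖y‖ < 1) :
    ballDiff z y ≤ 2 * Real.log 2 + Real.log (4 / (1 - ‖z‖ ^ 2)) := by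
  have h1 := one_sub_norm_sq_pos hz
  have h3 : 0 < ‖(1 : ℂ) - inner ℂ y z‖ := norm_pos_iff.2 (one_sub_inner_ne_zero hz hy.le)
  have h4 : ‖(1 : ℂ) - inner ℂ y z‖ ≤ 2 := by
    have := norm_sub_le (1 : ℂ) (inner ℂ y z)
    rw [norm_one] at this
    linarith [norm_inner_lt_one hz hy.le]
  have h5 := pseudoDist_nonneg z y
  have h6 := pseudoDist_lt_one hz hy
  have h7 : Real.log (1 + pseudoDist z y) ≤ Real.log 2 :=
    Real.log_le_log (by linarith) (by linarith)
  have h8 : 0 ≤ Real.log (1 + ‖y‖) := Real.log_nonneg (by linarith [norm_nonneg y])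
  have h9 : Real.log (‖(1 : ℂ) - inner ℂ y z‖ ^ 2 / (1 - ‖z‖ ^ 2))
      ≤ Real.log (4 / (1 - ‖z‖ ^ 2)) := by
    refine Real.log_le_log (by positivity) ?_
    gcongr
    nlinarith
  unfold ballDiff
  linarith

/-- The function `t ↦ tanh (t / 2)`, the inverse of `radialDist`. -/
noncomputable def tanhHalf (t : ℝ) : ℝ := (Real.exp t - 1) / (Real.exp t + 1)

theorem tanhHalf_nonneg {t : ℝ} (ht : 0 ≤ t) : 0 ≤ tanhHalf t :=
  div_nonneg (by linarith [Real.one_le_exp ht]) (by positivity)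

theorem tanhHalf_lt_one (t : ℝ) : tanhHalf t < 1 := by
  rw [tanhHalf, div_lt_one (by positivity)]; linarith

theorem radialDist_tanhHalf (t : ℝ) : radialDist (tanhHalf t) = t := by
  have h : (1 + tanhHalf t) / (1 - tanhHalf t) = Real.exp t := by
    have h1 : 0 < Real.exp t + 1 := by positivity
    have h2 : 1 - tanhHalf t = 2 / (Real.exp t + 1) := by
      rw [tanhHalf]; field_simp; ring
    have h3 : 1 + tanhHalf t = 2 * Real.exp t / (Real.exp t + 1) := by
      rw [tanhHalf]; field_simp; ring
    rw [h2, h3]; field_simp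
  rw [radialDist, h, Real.log_exp]

theorem tendsto_tanhHalf : Tendsto tanhHalf atTop (𝓝 1) := by
  have h1 : Tendsto (fun t => 1 - 2 / (Real.exp t + 1)) atTop (𝓝 (1 - 0)) :=
    tendsto_const_nhds.sub (tendsto_const_nhds.div_atTop
      (tendsto_atTop_add_const_right _ _ Real.tendsto_exp_atTop))
  rw [sub_zero] at h1
  refine h1.congr fun t => ?_
  have : Real.exp t + 1 ≠ 0 := by positivity
  rw [tanhHalf]; field_simp; ring

theorem norm_tanhHalf_smul {ξ : E} (hξ : ‖ξ‖ = 1) {t : ℝ} (ht : 0 ≤ t) :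
    ‖(tanhHalf t : ℂ) • ξ‖ = tanhHalf t := by
  rw [norm_smul, hξ, mul_one, Complex.norm_real, Real.norm_of_nonneg (tanhHalf_nonneg ht)]

/-- The radius to `ξ` is a geodesic parametrized by arc length: this is the subtraction formula for
`tanh`. -/
theorem ballDist_tanhHalf_smul {ξ : E} (hξ : ‖ξ‖ = 1) {s t : ℝ} (hs : 0 ≤ s) (ht : 0 ≤ t) :
    ballDist ((tanhHalf s : ℂ) • ξ) ((tanhHalf t : ℂ) • ξ) = |s - t| := by
  have hξξ : inner ℂ ξ ξ = (1 : ℂ) := by rw [inner_self_eq_norm_sq_to_K, hξ]; simp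
  have hinner : (1 : ℂ) - inner ℂ ((tanhHalf t : ℂ) • ξ) ((tanhHalf s : ℂ) • ξ)
      = ((1 - tanhHalf s * tanhHalf t : ℝ) : ℂ) := by
    rw [inner_smul_left, inner_smul_right, hξξ, Complex.conj_ofReal]; push_cast; ring
  have hs1 : 0 < Real.exp s + 1 := by positivity
  have ht1 : 0 < Real.exp t + 1 := by positivity
  have hst : 0 < Real.exp s + Real.exp t := by positivity
  have h1 : 1 - tanhHalf s ^ 2 = 4 * Real.exp s / (Real.exp s + 1) ^ 2 := by
    rw [tanhHalf]; field_simp; ring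
  have h2 : 1 - tanhHalf t ^ 2 = 4 * Real.exp t / (Real.exp t + 1) ^ 2 := by
    rw [tanhHalf]; field_simp; ring
  have h3 : 1 - tanhHalf s * tanhHalf t
      = 2 * (Real.exp s + Real.exp t) / ((Real.exp s + 1) * (Real.exp t + 1)) := by
    rw [tanhHalf, tanhHalf]; field_simp; ring
  have h4 : 1 - ballRatio ((tanhHalf s : ℂ) • ξ) ((tanhHalf t : ℂ) • ξ)
      = (tanhHalf |s - t|) ^ 2 := by
    rw [ballRatio, hinner, norm_tanhHalf_smul hξ hs, norm_tanhHalf_smul hξ ht, h1, h2,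
      Complex.norm_real, Real.norm_eq_abs, sq_abs, h3]
    have h5 : 0 < Real.exp |s - t| + 1 := by positivity
    rcases le_total t s with h | h
    · rw [abs_of_nonneg (by linarith), tanhHalf, Real.exp_sub]
      field_simp
      ring
    · rw [abs_of_nonpos (by linarith), neg_sub, tanhHalf, Real.exp_sub]
      field_simp
      ring
  rw [ballDist, pseudoDist, h4, Real.sqrt_sq (tanhHalf_nonneg (abs_nonneg _)), radialDist_tanhHalf]

end Boundary

/-! ### Horofunctions of a single ball -/

section Euclidean

variable {m : ℕ}

theorem ballDiff_of_norm_eq_one {ξ z : EuclideanSpace ℂ (Fin m)} (hξ : ‖ξ‖ = 1) :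
    ballDiff z ξ = ballHoro ξ z := by
  rw [ballDiff, ballHoro, pseudoDist, ballRatio, hξ]
  simp

/-- By Cauchy–Schwarz `|1 - ⟨z, ξ⟩| ≥ 1 - ‖z‖`. Equality holds on the radius to `ξ`, which makes the
detour estimates sharp. -/
theorem neg_radialDist_le_ballHoro {ξ z : EuclideanSpace ℂ (Fin m)} (hξ : ‖ξ‖ = 1)
    (hz : ‖z‖ < 1) : -radialDist ‖z‖ ≤ ballHoro ξ z := by
  have h1 := one_sub_norm_sq_pos hz
  have hn := norm_nonneg z
  have h2 : 1 - ‖z‖ ≤ ‖1 - (inner ℂ ξ z : ℂ)‖ := by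
    have h3 : 1 - ‖(inner ℂ ξ z : ℂ)‖ ≤ ‖1 - (inner ℂ ξ z : ℂ)‖ := by
      simpa using norm_sub_norm_le (1 : ℂ) (inner ℂ ξ z)
    have h4 := norm_inner_le_norm (𝕜 := ℂ) ξ z
    rw [hξ, one_mul] at h4
    linarith
  rw [radialDist, ← Real.log_inv, inv_div, ballHoro]
  refine Real.log_le_log (div_pos (by linarith) (by linarith)) ?_
  rw [div_le_div_iff₀ (by linarith) h1]
  have h5 : (1 - ‖z‖) ^ 2 ≤ ‖1 - (inner ℂ ξ z : ℂ)‖ ^ 2 :=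
    pow_le_pow_left₀ (by linarith) h2 2
  nlinarith

theorem ballHoro_tanhHalf_smul {ξ : EuclideanSpace ℂ (Fin m)} (hξ : ‖ξ‖ = 1) {t : ℝ}
    (ht : 0 ≤ t) : ballHoro ξ ((tanhHalf t : ℂ) • ξ) = -t := by
  have hξξ : inner ℂ ξ ξ = (1 : ℂ) := by rw [inner_self_eq_norm_sq_to_K, hξ]; simp
  have h1 : (1 : ℂ) - inner ℂ ξ ((tanhHalf t : ℂ) • ξ) = ((1 - tanhHalf t : ℝ) : ℂ) := by
    rw [inner_smul_right, hξξ]; push_cast; ring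
  have h2 := tanhHalf_nonneg ht
  have h3 := tanhHalf_lt_one t
  have h4 : (1 - tanhHalf t) ^ 2 / (1 - tanhHalf t ^ 2)
      = ((1 + tanhHalf t) / (1 - tanhHalf t))⁻¹ := by
    have h5 : 1 - tanhHalf t ^ 2 = (1 - tanhHalf t) * (1 + tanhHalf t) := by ring
    have h6 : 1 - tanhHalf t ≠ 0 := by linarith
    have h7 : 1 + tanhHalf t ≠ 0 := by linarith
    rw [h5, inv_div]; field_simp
  rw [ballHoro, h1, norm_tanhHalf_smul hξ ht, Complex.norm_real,
    Real.norm_of_nonneg (by linarith), h4, Real.log_inv, ← radialDist, radialDist_tanhHalf]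

/-- The numerator has a nonzero limit, by the equality case of Cauchy–Schwarz, while the denominator
tends to `0`. -/
theorem tendsto_ballHoro_atTop {X : Type*} {l : Filter X} {y : X → EuclideanSpace ℂ (Fin m)}
    {ξ η : EuclideanSpace ℂ (Fin m)} (hξ : ‖ξ‖ = 1) (hη : ‖η‖ = 1) (hne : ξ ≠ η)
    (hy : ∀ x, ‖y x‖ < 1) (h : Tendsto y l (𝓝 η)) :
    Tendsto (fun x => ballHoro ξ (y x)) l atTop := by
  have h1 : (1 : ℂ) - inner ℂ ξ η ≠ 0 := fun h0 =>
    hne ((inner_eq_one_iff_of_norm_eq_one hξ hη).1 (sub_eq_zero.1 h0).symm)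
  have h2 : Tendsto (fun x => ‖(1 : ℂ) - inner ℂ ξ (y x)‖ ^ 2) l
      (𝓝 (‖(1 : ℂ) - inner ℂ ξ η‖ ^ 2)) :=
    ((tendsto_const_nhds.sub (tendsto_const_nhds.inner h)).norm).pow 2
  have h3 : Tendsto (fun x => 1 - ‖y x‖ ^ 2) l (𝓝[>] 0) := by
    refine tendsto_nhdsWithin_iff.2 ⟨?_, Eventually.of_forall fun x => one_sub_norm_sq_pos (hy x)⟩
    have := (tendsto_const_nhds (x := (1 : ℝ))).sub (h.norm.pow 2)
    simpa [hη] using this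
  refine Real.tendsto_log_atTop.comp ?_
  simp only [div_eq_mul_inv]
  exact h2.pos_mul_atTop (by positivity) h3.inv_tendsto_nhdsGT_zero

end Euclidean

/-! ### Suprema over finite types -/

section Sup

variable {ι : Type*}

theorem ciSup_lt_iff_of_finite [Finite ι] [Nonempty ι] {f : ι → ℝ} {a : ℝ} :
    ⨆ i, f i < a ↔ ∀ i, f i < a := by
  refine ⟨fun h i => (le_ciSup (Set.finite_range f).bddAbove i).trans_lt h, fun h => ?_⟩
  obtain ⟨i, hi⟩ := exists_eq_ciSup_of_finite (f := f)
  exact hi ▸ h i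

theorem lt_ciSup_iff_of_finite [Finite ι] [Nonempty ι] {f : ι → ℝ} {a : ℝ} :
    a < ⨆ i, f i ↔ ∃ i, a < f i :=
  lt_ciSup_iff (Set.finite_range f).bddAbove

/-- The maximum of finitely many functions, of which those outside `J` tend to `-∞` and the others
converge, converges to the maximum of the limits over `J`. -/
theorem tendsto_ciSup_sup' {X : Type*} [Finite ι] {l : Filter X} {J : Finset ι} (hJ : J.Nonempty)
    {F : X → ι → ℝ} {L : J → ℝ} (h : ∀ j : J, Tendsto (fun x => F x j) l (𝓝 (L j)))
    (h' : ∀ i ∉ J, Tendsto (fun x => F x i) l atBot) :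
    Tendsto (fun x => ⨆ i, F x i) l (𝓝 (J.attach.sup' hJ.attach L)) := by
  obtain ⟨i₀, hi₀⟩ := hJ
  have : Nonempty ι := ⟨i₀⟩
  refine tendsto_order.2 ⟨fun a ha => ?_, fun a ha => ?_⟩
  · obtain ⟨j, -, hj⟩ := (Finset.lt_sup'_iff _).1 ha
    filter_upwards [(h j).eventually_const_lt hj] with x hx
    exact lt_ciSup_iff_of_finite.2 ⟨j, hx⟩
  · simp only [ciSup_lt_iff_of_finite, eventually_all]
    intro i
    by_cases hi : i ∈ J
    · exact (h ⟨i, hi⟩).eventually_lt_const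
        ((Finset.sup'_lt_iff _).1 ha ⟨i, hi⟩ (Finset.mem_attach _ _))
    · exact (h' i hi).eventually_lt_atBot a

theorem attach_sup'_eq_ciSup {J : Finset ι} (hJ : J.Nonempty) (f : J → ℝ) :
    J.attach.sup' hJ.attach f = ⨆ j, f j :=
  have : Nonempty J := hJ.to_subtype
  Finset.sup'_univ_eq_ciSup f

theorem tendsto_ciSup_nhds {X : Type*} [Finite ι] {l : Filter X} {F : X → ι → ℝ} {L : ι → ℝ}
    (h : ∀ i, Tendsto (fun x => F x i) l (𝓝 (L i))) :
    Tendsto (fun x => ⨆ i, F x i) l (𝓝 (⨆ i, L i)) := by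
  rcases isEmpty_or_nonempty ι with hι | hι
  · simp only [Real.iSup_of_isEmpty]
    exact tendsto_const_nhds
  · refine tendsto_order.2 ⟨fun a ha => ?_, fun a ha => ?_⟩
    · obtain ⟨i, hi⟩ := lt_ciSup_iff_of_finite.1 ha
      filter_upwards [(h i).eventually_const_lt hi] with x hx
      exact lt_ciSup_iff_of_finite.2 ⟨i, hx⟩
    · simp only [ciSup_lt_iff_of_finite, eventually_all] at ha ⊢
      exact fun i => (h i).eventually_lt_const (ha i)

/-- Compactness of `[0, ∞]`, used for the gaps. -/
theorem ultrafilter_tendsto_nhds_or_atTop {X : Type*} (u : Ultrafilter X) {a : X → ℝ}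
    (ha : ∀ x, 0 ≤ a x) : (∃ c, 0 ≤ c ∧ Tendsto a u (𝓝 c)) ∨ Tendsto a u atTop := by
  by_cases h : ∃ C, ∀ᶠ x in u, a x ≤ C
  · obtain ⟨C, hC⟩ := h
    obtain ⟨c, hc, hc'⟩ := (isCompact_Icc (a := (0 : ℝ)) (b := C)).ultrafilter_le_nhds (u.map a)
      (le_principal_iff.2 (hC.mono fun x hx => ⟨ha x, hx⟩))
    exact Or.inl ⟨c, hc.1, hc'⟩
  · rw [not_exists] at h
    refine Or.inr (tendsto_atTop.2 fun C => ?_)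
    exact (Ultrafilter.eventually_not.2 (h C)).mono fun x hx => (not_le.1 hx).le

end Sup

/-! ### Limits of internal functions -/

section Product

variable {q : ℕ} {n : Fin q → ℕ}

theorem kob_origin (z : ballProd n) : kob n (origin n) z = ⨆ j, radialDist ‖z.1 j‖ := by
  rw [kob_eq]
  exact iSup_congr fun j => ballDist_zero_left _

theorem radialDist_le_kob (z : ballProd n) (j : Fin q) :
    radialDist ‖z.1 j‖ ≤ kob n (origin n) z := by
  rw [kob_origin]
  exact le_ciSup (f := fun j => radialDist ‖z.1 j‖) (Set.finite_range _).bddAbove j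

theorem kob_nonneg (z w : ballProd n) : 0 ≤ kob n z w := by
  rw [kob_eq]
  exact Real.iSup_nonneg fun j => ballDist_nonneg (z.2 j) (w.2 j)

/-- Along the filter `l`, the points `y` leave every bounded set, in such a way that the
coordinates in `J` go to the boundary points `ξ`, at distances from the origin that lag behind by
`α` in the limit, while the other coordinates lag behind by infinity. -/
structure IsHoroLimit {X : Type*} (l : Filter X) (y : X → ballProd n) (J : Finset (Fin q))
    (ξ : (j : J) → EuclideanSpace ℂ (Fin (n j))) (α : J → ℝ) : Prop where
  tendsto_dist : Tendsto (fun x => kob n (origin n) (y x)) l atTop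
  norm_eq : ∀ j, ‖ξ j‖ = 1
  tendsto_point : ∀ j : J, Tendsto (fun x => (y x).1 j) l (𝓝 (ξ j))
  tendsto_gap : ∀ j : J,
    Tendsto (fun x => kob n (origin n) (y x) - radialDist ‖(y x).1 j‖) l (𝓝 (α j))
  tendsto_gap_top : ∀ j ∉ J,
    Tendsto (fun x => kob n (origin n) (y x) - radialDist ‖(y x).1 j‖) l atTop

theorem IsHoroLimit.tendsto {X : Type*} {l : Filter X} {y : X → ballProd n} {J : Finset (Fin q)}
    {ξ : (j : J) → EuclideanSpace ℂ (Fin (n j))} {α : J → ℝ} (h : IsHoroLimit l y J ξ α)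
    (hJ : J.Nonempty) (z : ballProd n) :
    Tendsto (fun x => internalFunction (kob n) (origin n) (y x) z) l (𝓝 (prodHoro hJ ξ α z)) := by
  have : Nonempty (Fin q) := ⟨hJ.choose⟩
  have key : ∀ x, internalFunction (kob n) (origin n) (y x) z = ⨆ j, (ballDiff (z.1 j) ((y x).1 j)
      - (kob n (origin n) (y x) - radialDist ‖(y x).1 j‖)) := by
    intro x
    rw [internalFunction, kob_eq n z, ciSup_sub (Set.finite_range _).bddAbove]
    refine iSup_congr fun j => ?_
    rw [ballDist_eq_add (z.2 j) ((y x).2 j)]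
    ring
  simp only [key]
  refine tendsto_ciSup_sup' hJ (fun j => ?_) (fun j hj => ?_)
  · refine Tendsto.sub ?_ (h.tendsto_gap j)
    rw [← ballDiff_of_norm_eq_one (h.norm_eq j)]
    exact (continuousAt_ballDiff (z.2 j) (h.norm_eq j).le).tendsto.comp (h.tendsto_point j)
  · simp only [sub_eq_add_neg _ (kob n (origin n) _ - _)]
    exact tendsto_atBot_add_left_of_ge _ _ (fun x => ballDiff_le (z.2 j) ((y x).2 j))
      (tendsto_neg_atTop_atBot.comp (h.tendsto_gap_top j hj))

theorem continuousAt_radialDist {m : ℝ} (h0 : 0 ≤ m) (h1 : m < 1) :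
    ContinuousAt radialDist m := by
  have h2 : 1 - m ≠ 0 := by linarith
  refine ContinuousAt.log (ContinuousAt.div (by fun_prop) (by fun_prop) h2) ?_
  exact (div_pos (by linarith) (by linarith)).ne'

theorem tendsto_ballDist {m : ℕ} {X : Type*} {l : Filter X} {y : X → EuclideanSpace ℂ (Fin m)}
    {z η : EuclideanSpace ℂ (Fin m)} (hz : ‖z‖ < 1) (hη : ‖η‖ < 1) (hy : ∀ x, ‖y x‖ < 1)
    (h : Tendsto y l (𝓝 η)) : Tendsto (fun x => ballDist z (y x)) l (𝓝 (ballDist z η)) := by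
  simp only [fun x => ballDist_eq_add hz (hy x), ballDist_eq_add hz hη]
  refine ((continuousAt_ballDiff hz hη.le).tendsto.comp h).add ?_
  exact (continuousAt_radialDist (norm_nonneg η) hη).tendsto.comp h.norm

theorem tendsto_kob {X : Type*} {l : Filter X} {y : X → ballProd n} {η : ballProd n}
    (h : ∀ j, Tendsto (fun x => (y x).1 j) l (𝓝 (η.1 j))) (z : ballProd n) :
    Tendsto (fun x => kob n z (y x)) l (𝓝 (kob n z η)) := by
  simp only [kob_eq]
  exact tendsto_ciSup_nhds fun j => tendsto_ballDist (z.2 j) (η.2 j) (fun x => (y x).2 j) (h j)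

/-- Along an ultrafilter, a family of points in the product of balls either converges or tends to
a horofunction. -/
theorem exists_tendsto_or_isHoroLimit {X : Type*} (u : Ultrafilter X) (y : X → ballProd n) :
    (∃ η : ballProd n, ∀ z, Tendsto (fun x => internalFunction (kob n) (origin n) (y x) z) u
      (𝓝 (internalFunction (kob n) (origin n) η z))) ∨
    ∃ (J : Finset (Fin q)) (_ : J.Nonempty) (ξ : (j : J) → EuclideanSpace ℂ (Fin (n j)))
      (α : J → ℝ), IsLeast (range α) 0 ∧ IsHoroLimit u y J ξ α := by
  have hlim : ∀ j, ∃ η : EuclideanSpace ℂ (Fin (n j)), ‖η‖ ≤ 1 ∧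
      Tendsto (fun x => (y x).1 j) u (𝓝 η) := by
    intro j
    have hmem : ∀ᶠ x in (u : Filter X), (y x).1 j ∈ closedBall 0 1 :=
      Eventually.of_forall fun x => by simpa using ((y x).2 j).le
    obtain ⟨η, hη, hη'⟩ := (isCompact_closedBall (0 : EuclideanSpace ℂ (Fin (n j))) 1
      ).ultrafilter_le_nhds (u.map fun x => (y x).1 j) (le_principal_iff.2 hmem)
    exact ⟨η, by simpa using hη, hη'⟩
  choose η hη hη' using hlim
  by_cases hin : ∀ j, ‖η j‖ < 1
  · refine Or.inl ⟨⟨η, hin⟩, fun z => ?_⟩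
    exact (tendsto_kob (η := ⟨η, hin⟩) hη' z).sub (tendsto_kob (η := ⟨η, hin⟩) hη' _)
  right
  push Not at hin
  obtain ⟨i, hi⟩ := hin
  have : Nonempty (Fin q) := ⟨i⟩
  have hi1 : ‖η i‖ = 1 := le_antisymm (hη i) hi
  have hdist : Tendsto (fun x => kob n (origin n) (y x)) u atTop := by
    refine tendsto_atTop_mono (fun x => radialDist_le_kob (y x) i) ?_
    have h1 : Tendsto (fun x => 1 - ‖(y x).1 i‖) u (𝓝[>] 0) := by
      refine tendsto_nhdsWithin_iff.2
        ⟨?_, Eventually.of_forall fun x => sub_pos.2 ((y x).2 i)⟩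
      simpa [hi1] using (tendsto_const_nhds (x := (1 : ℝ))).sub (hη' i).norm
    have h2 : Tendsto (fun x => 1 + ‖(y x).1 i‖) u (𝓝 2) := by
      convert (tendsto_const_nhds (x := (1 : ℝ))).add (hη' i).norm using 2
      rw [hi1]; norm_num
    refine Real.tendsto_log_atTop.comp ?_
    simp only [div_eq_mul_inv]
    exact h2.pos_mul_atTop two_pos h1.inv_tendsto_nhdsGT_zero
  set gap : Fin q → X → ℝ := fun j x => kob n (origin n) (y x) - radialDist ‖(y x).1 j‖ with hgap
  have hgap0 : ∀ j x, 0 ≤ gap j x := fun j x => sub_nonneg.2 (radialDist_le_kob (y x) j)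
  classical
  set J : Finset (Fin q) := Finset.univ.filter fun j => ∃ c, 0 ≤ c ∧ Tendsto (gap j) u (𝓝 c)
    with hJdef
  have hJ : ∀ j : J, ∃ c, 0 ≤ c ∧ Tendsto (gap j) u (𝓝 c) := fun j =>
    (Finset.mem_filter.1 j.2).2
  choose α hα0 hα using hJ
  -- For each `x` some coordinate attains the maximum; among finitely many, the ultrafilter selects
  -- one. It yields `min α = 0`.
  obtain ⟨i₀, hi₀⟩ : ∃ i₀, ∀ᶠ x in u, gap i₀ x = 0 := by
    refine Ultrafilter.eventually_exists_iff.1 (Eventually.of_forall fun x => ?_)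
    obtain ⟨k, hk⟩ := exists_eq_ciSup_of_finite (f := fun j => radialDist ‖(y x).1 j‖)
    exact ⟨k, by simp only [hgap]; rw [kob_origin, ← hk, sub_self]⟩
  have hi₀' : Tendsto (gap i₀) u (𝓝 0) :=
    tendsto_const_nhds.congr' (hi₀.mono fun x hx => hx.symm)
  have hi₀J : i₀ ∈ J := by
    simpa [hJdef] using ⟨0, le_rfl, hi₀'⟩
  refine ⟨J, ⟨i₀, hi₀J⟩, fun j => η j, α, ⟨⟨⟨i₀, hi₀J⟩, ?_⟩, ?_⟩, hdist, fun j => ?_,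
    fun j => hη' j, hα, fun j hj => ?_⟩
  · exact tendsto_nhds_unique (hα ⟨i₀, hi₀J⟩) hi₀'
  · rintro _ ⟨j, rfl⟩
    exact hα0 j
  -- A coordinate with an interior limit stays at bounded distance from the origin, so its gap could
  -- not remain finite.
  · by_contra hne
    have hlt : ‖η j‖ < 1 := lt_of_le_of_ne (hη j) hne
    have h1 : Tendsto (fun x => radialDist ‖(y x).1 j‖) u (𝓝 (radialDist ‖η j‖)) :=
      (continuousAt_radialDist (norm_nonneg _) hlt).tendsto.comp (hη' j).norm
    refine not_tendsto_nhds_of_tendsto_atTop hdist _ (((hα j).add h1).congr fun x => ?_)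
    simp [hgap]
  · refine (ultrafilter_tendsto_nhds_or_atTop u (hgap0 j)).resolve_left fun h => hj ?_
    simpa [hJdef] using h

/-- If `d(b, y) + h'(y)` stays bounded by `C` along `y` tending to a horofunction `h`, then the
data of `h'` are compatible with those of `h`. -/
theorem IsHoroLimit.exists_mem_of_le {X : Type*} {l : Filter X} [l.NeBot] {y : X → ballProd n}
    {J : Finset (Fin q)} {ξ : (j : J) → EuclideanSpace ℂ (Fin (n j))} {α : J → ℝ}
    (h : IsHoroLimit l y J ξ α) {J' : Finset (Fin q)} {hJ' : J'.Nonempty}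
    {ξ' : (j : J') → EuclideanSpace ℂ (Fin (n j))} {α' : J' → ℝ} (hξ' : ∀ j, ‖ξ' j‖ = 1) {C : ℝ}
    (hC : ∀ᶠ x in l, kob n (origin n) (y x) + prodHoro hJ' ξ' α' (y x) ≤ C) (j : J') :
    ∃ hj : j.1 ∈ J, ξ' j = ξ ⟨j, hj⟩ ∧ α ⟨j, hj⟩ - α' j ≤ C := by
  have h1 : ∀ᶠ x in l, kob n (origin n) (y x) + ballHoro (ξ' j) ((y x).1 j) ≤ C + α' j := by
    filter_upwards [hC] with x hx
    have := Finset.le_sup' (fun j : J' => ballHoro (ξ' j) ((y x).1 j) - α' j)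
      (Finset.mem_attach J' j)
    rw [prodHoro] at hx
    linarith
  have h2 : ∀ᶠ x in l, kob n (origin n) (y x) - radialDist ‖(y x).1 j‖ ≤ C + α' j := by
    filter_upwards [h1] with x hx
    linarith [neg_radialDist_le_ballHoro (hξ' j) ((y x).2 j)]
  have hj : j.1 ∈ J := by
    by_contra hj
    obtain ⟨x, hx, hx'⟩ := (h2.and ((h.tendsto_gap_top j hj).eventually_gt_atTop _)).exists
    exact absurd hx (not_le.2 hx')
  refine ⟨hj, ?_, ?_⟩
  · by_contra hne
    have h3 := tendsto_ballHoro_atTop (hξ' j) (h.norm_eq ⟨j, hj⟩) hne (fun x => (y x).2 j)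
      (h.tendsto_point ⟨j, hj⟩)
    obtain ⟨x, hx, hx'⟩ := (h1.and (h3.eventually_gt_atTop (C + α' j))).exists
    linarith [kob_nonneg (origin n) (y x)]
  · linarith [le_of_tendsto (h.tendsto_gap ⟨j, hj⟩) h2]

/-! ### Geodesic rays -/

/-- The points of a geodesic ray that goes to the horofunction with data `J`, `ξ`, `α`. -/
noncomputable def ray {J : Finset (Fin q)} (ξ : (j : J) → EuclideanSpace ℂ (Fin (n j)))
    (α : J → ℝ) (t : ℝ) : (j : Fin q) → EuclideanSpace ℂ (Fin (n j)) :=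
  fun j => if hj : j ∈ J then (tanhHalf (t - α ⟨j, hj⟩) : ℂ) • ξ ⟨j, hj⟩ else 0

section Ray

variable {J : Finset (Fin q)} {ξ : (j : J) → EuclideanSpace ℂ (Fin (n j))} {α : J → ℝ}

theorem ray_mem (hξ : ∀ j, ‖ξ j‖ = 1) {t : ℝ} (ht : ∀ j, α j ≤ t) : ray ξ α t ∈ ballProd n := by
  intro j
  by_cases hj : j ∈ J
  · rw [ray, dif_pos hj, norm_tanhHalf_smul (hξ _) (sub_nonneg.2 (ht _))]
    exact tanhHalf_lt_one _
  · simp [ray, hj]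

theorem kob_ray (hJ : J.Nonempty) (hξ : ∀ j, ‖ξ j‖ = 1) {s t : ℝ} (hs : ∀ j, α j ≤ s)
    (ht : ∀ j, α j ≤ t) : kob n ⟨ray ξ α s, ray_mem hξ hs⟩ ⟨ray ξ α t, ray_mem hξ ht⟩ = |s - t| := by
  obtain ⟨i, hi⟩ := hJ
  have : Nonempty (Fin q) := ⟨i⟩
  have key : ∀ j, j ∈ J → ballDist (ray ξ α s j) (ray ξ α t j) = |s - t| := by
    intro j hj
    rw [ray, ray, dif_pos hj, dif_pos hj, ballDist_tanhHalf_smul (hξ _) (sub_nonneg.2 (hs _))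
      (sub_nonneg.2 (ht _))]
    congr 1; ring
  rw [kob_eq]
  refine le_antisymm (ciSup_le fun j => ?_) ?_
  · by_cases hj : j ∈ J
    · exact (key j hj).le
    · simp only [ray, dif_neg hj]
      rw [ballDist_zero_left]
      simp
  · rw [← key i hi]
    exact le_ciSup (f := fun j => ballDist (ray ξ α s j) (ray ξ α t j))
      (Set.finite_range _).bddAbove i

theorem radialDist_norm_ray (hξ : ∀ j, ‖ξ j‖ = 1) {t : ℝ} (ht : ∀ j, α j ≤ t) (j : J) :
    radialDist ‖ray ξ α t j‖ = t - α j := by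
  rw [ray, dif_pos j.2, norm_tanhHalf_smul (hξ _) (sub_nonneg.2 (ht _)), radialDist_tanhHalf]

theorem kob_origin_ray (hξ : ∀ j, ‖ξ j‖ = 1) (hα : IsLeast (range α) 0) {t : ℝ}
    (ht : ∀ j, α j ≤ t) : kob n (origin n) ⟨ray ξ α t, ray_mem hξ ht⟩ = t := by
  obtain ⟨⟨i, hi⟩, hα0⟩ := hα
  have : Nonempty (Fin q) := ⟨i⟩
  refine le_antisymm ?_ ?_
  · rw [kob_origin]
    refine ciSup_le fun j => ?_
    by_cases hj : j ∈ J
    · have h1 := radialDist_norm_ray hξ ht ⟨j, hj⟩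
      have h2 := hα0 ⟨⟨j, hj⟩, rfl⟩
      simp only at h1 ⊢
      linarith
    · simp only [ray, dif_neg hj, norm_zero, radialDist_zero]
      exact hi ▸ ht i
  · have h1 := radialDist_norm_ray hξ ht i
    rw [hi, sub_zero] at h1
    exact h1.symm.le.trans (radialDist_le_kob ⟨ray ξ α t, ray_mem hξ ht⟩ i.1)

theorem ballHoro_ray (hξ : ∀ j, ‖ξ j‖ = 1) {t : ℝ} (ht : ∀ j, α j ≤ t) (j : J) :
    ballHoro (ξ j) (ray ξ α t j) = α j - t := by
  rw [ray, dif_pos j.2, ballHoro_tanhHalf_smul (hξ _) (sub_nonneg.2 (ht _)), neg_sub]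

/-- The horofunction decreases at unit speed along the ray, so `t` cancels. -/
theorem add_prodHoro_ray (hJ : J.Nonempty) (hξ : ∀ j, ‖ξ j‖ = 1) (hα : IsLeast (range α) 0) {t : ℝ}
    (ht : ∀ j, α j ≤ t) (α' : J → ℝ) :
    kob n (origin n) ⟨ray ξ α t, ray_mem hξ ht⟩ + prodHoro hJ ξ α' ⟨ray ξ α t, ray_mem hξ ht⟩ =
      ⨆ j, (α j - α' j) := by
  have : Nonempty J := hJ.to_subtype
  rw [kob_origin_ray hξ hα ht, prodHoro]
  simp only [ballHoro_ray hξ ht]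
  rw [attach_sup'_eq_ciSup hJ, add_comm,
    ciSup_add (Set.finite_range _).bddAbove]
  exact iSup_congr fun j => by ring

theorem isHoroLimit_ray (hξ : ∀ j, ‖ξ j‖ = 1) (hα : IsLeast (range α) 0) {C : ℝ}
    (hC' : ∀ (k : ℕ) (j : J), α j ≤ k + C) :
    IsHoroLimit atTop (fun k : ℕ => (⟨ray ξ α (k + C), ray_mem hξ (hC' k)⟩ : ballProd n)) J ξ α where
  tendsto_dist := by
    simp only [fun k : ℕ => kob_origin_ray hξ hα (hC' k)]
    exact tendsto_atTop_add_const_right _ _ tendsto_natCast_atTop_atTop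
  norm_eq := hξ
  tendsto_point j := by
    have h1 : Tendsto (fun k : ℕ => (tanhHalf (k + C - α j) : ℂ)) atTop (𝓝 ((1 : ℝ) : ℂ)) := by
      refine (Complex.continuous_ofReal.tendsto 1).comp (tendsto_tanhHalf.comp ?_)
      simp only [add_sub_assoc]
      exact tendsto_atTop_add_const_right _ _ tendsto_natCast_atTop_atTop
    have h2 := h1.smul_const (ξ j)
    simp only [Complex.ofReal_one, one_smul] at h2
    refine h2.congr fun k => ?_
    simp [ray]
  tendsto_gap j := by
    simp only [fun k : ℕ => kob_origin_ray hξ hα (hC' k), fun k : ℕ => radialDist_norm_ray hξ (hC' k) j, sub_sub_cancel]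
    exact tendsto_const_nhds
  tendsto_gap_top j hj := by
    simp only [fun k : ℕ => kob_origin_ray hξ hα (hC' k), ray, dif_neg hj, norm_zero, radialDist_zero, sub_zero]
    exact tendsto_atTop_add_const_right _ _ tendsto_natCast_atTop_atTop

/-- Every horofunction with data `J`, `ξ`, `α` is the limit of a geodesic ray `y`. -/
theorem exists_ray (hJ : J.Nonempty) (hξ : ∀ j, ‖ξ j‖ = 1) (hα : IsLeast (range α) 0) :
    ∃ y : ℕ → ballProd n, (∀ k m, kob n (y k) (y m) = |(k : ℝ) - m|) ∧ IsHoroLimit atTop y J ξ α ∧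
      ∀ α' k, kob n (origin n) (y k) + prodHoro hJ ξ α' (y k) = ⨆ j, (α j - α' j) := by
  -- The ray starts at time `C`, when every `t - α j` is already nonnegative.
  obtain ⟨C, hC⟩ := (Set.finite_range α).bddAbove
  have hC1 : ∀ j, α j ≤ C := fun j => hC ⟨j, rfl⟩
  have hC2 : ∀ (k : ℕ) (j : J), α j ≤ k + C := fun k j =>
    (hC1 j).trans (le_add_of_nonneg_left k.cast_nonneg)
  refine ⟨_, fun k m => ?_, isHoroLimit_ray hξ hα hC2,
    fun α' k => add_prodHoro_ray hJ hξ hα (hC2 k) α'⟩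
  rw [kob_ray hJ hξ (hC2 k) (hC2 m)]
  congr 1; ring

end Ray

end Product

section Horofunctions

variable {q : ℕ} {n : Fin q → ℕ}

/-! ### Horofunctions and Busemann points -/

section Data

variable {J J' : Finset (Fin q)} {ξ : (j : J) → EuclideanSpace ℂ (Fin (n j))}
  {ξ' : (j : J') → EuclideanSpace ℂ (Fin (n j))} {α : J → ℝ} {α' : J' → ℝ}

theorem isHorofunction_prodHoro (hJ : J.Nonempty) (hξ : ∀ j, ‖ξ j‖ = 1)
    (hα : IsLeast (range α) 0) : IsHorofunction (kob n) (origin n) (prodHoro hJ ξ α) := by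
  obtain ⟨y, -, hy, hyα⟩ := exists_ray (n := n) hJ hξ hα
  refine ⟨mem_closure_of_tendsto (tendsto_pi_nhds.2 (hy.tendsto hJ))
    (Eventually.of_forall fun k => mem_range_self (y k)), ?_⟩
  rintro ⟨w, hw⟩
  -- On the ray `d(b, ·) + h` vanishes, whereas `d(b, ·) + h_w ≥ d(b, ·) - d(b, w)` is positive far
  -- out.
  obtain ⟨k, hk⟩ := (hy.tendsto_dist.eventually_gt_atTop (kob n (origin n) w)).exists
  have h1 := hyα α k
  simp only [sub_self, ← hw, internalFunction, Real.iSup_const_zero] at h1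
  linarith [kob_nonneg (y k) w]

theorem exists_eq_prodHoro_of_tendsto {X : Type*} (u : Ultrafilter X) {y : X → ballProd n}
    {h : ballProd n → ℝ} (hh : IsHorofunction (kob n) (origin n) h)
    (hy : ∀ z, Tendsto (fun x => internalFunction (kob n) (origin n) (y x) z) u (𝓝 (h z))) :
    ∃ (J : Finset (Fin q)) (hJ : J.Nonempty) (ξ : (j : J) → EuclideanSpace ℂ (Fin (n j)))
      (α : J → ℝ), IsLeast (range α) 0 ∧ IsHoroLimit u y J ξ α ∧ h = prodHoro hJ ξ α := by
  rcases exists_tendsto_or_isHoroLimit u y with ⟨η, hη⟩ | ⟨J, hJ, ξ, α, hα, hl⟩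
  · exact absurd ⟨η, funext fun z => tendsto_nhds_unique (hη z) (hy z)⟩ hh.2
  · exact ⟨J, hJ, ξ, α, hα, hl, funext fun z => tendsto_nhds_unique (hy z) (hl.tendsto hJ z)⟩

theorem isHorofunction_iff (h : ballProd n → ℝ) :
    IsHorofunction (kob n) (origin n) h ↔
      ∃ (J : Finset (Fin q)) (hJ : J.Nonempty) (ξ : (j : J) → EuclideanSpace ℂ (Fin (n j)))
        (α : J → ℝ), (∀ j, ‖ξ j‖ = 1) ∧ IsLeast (range α) 0 ∧ h = prodHoro hJ ξ α := by
  constructor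
  · intro hh
    -- The product topology need not be first countable, so the closure point is approached along
    -- the pullback of its neighbourhood filter instead of a sequence.
    have : (comap (internalFunction (kob n) (origin n)) (𝓝 h)).NeBot := by
      refine comap_neBot fun t ht => ?_
      obtain ⟨_, hx, y, rfl⟩ := mem_closure_iff_nhds.1 hh.1 t ht
      exact ⟨y, hx⟩
    obtain ⟨J, hJ, ξ, α, hα, hl, rfl⟩ := exists_eq_prodHoro_of_tendsto
      (Ultrafilter.of (comap (internalFunction (kob n) (origin n)) (𝓝 h))) (y := id) hh
      (tendsto_pi_nhds.1 (tendsto_comap.mono_left (Ultrafilter.of_le _)))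
    exact ⟨J, hJ, ξ, α, hl.norm_eq, hα, rfl⟩
  · rintro ⟨J, hJ, ξ, α, hξ, hα, rfl⟩
    exact isHorofunction_prodHoro hJ hξ hα

theorem isBusemannPoint_prodHoro (hJ : J.Nonempty) (hξ : ∀ j, ‖ξ j‖ = 1)
    (hα : IsLeast (range α) 0) : IsBusemannPoint (kob n) (origin n) (prodHoro hJ ξ α) := by
  obtain ⟨y, hy, hl, -⟩ := exists_ray (n := n) hJ hξ hα
  refine ⟨isHorofunction_prodHoro hJ hξ hα, y, ⟨?_, fun ε hε => ⟨0, fun m k _ hkm => ?_⟩⟩,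
    hl.tendsto hJ⟩
  · simp only [hy, Nat.cast_zero, sub_zero, Nat.abs_cast]
    exact tendsto_natCast_atTop_atTop
  · have h1 : (k : ℝ) ≤ m := by exact_mod_cast hkm
    rw [hy, hy, hy, abs_of_nonneg (sub_nonneg.2 h1)]
    simpa using hε

theorem IsHorofunction.isBusemannPoint {h : ballProd n → ℝ}
    (hh : IsHorofunction (kob n) (origin n) h) : IsBusemannPoint (kob n) (origin n) h := by
  obtain ⟨J, hJ, ξ, α, hξ, hα, rfl⟩ := (isHorofunction_iff h).1 hh
  exact isBusemannPoint_prodHoro hJ hξ hα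

/-! ### The detour distance -/

/-- On the ray to the first function `d(b, ·) + h` vanishes, so the compatibility lemma applies with
`C = 0`. Used in both directions, it shows that a horofunction determines its data. -/
theorem exists_mem_of_prodHoro_eq {hJ : J.Nonempty} {hJ' : J'.Nonempty} (hξ : ∀ j, ‖ξ j‖ = 1)
    (hα : IsLeast (range α) 0) (hξ' : ∀ j, ‖ξ' j‖ = 1)
    (h : (prodHoro hJ ξ α : ballProd n → ℝ) = prodHoro hJ' ξ' α') (j : J') :
    ∃ hj : j.1 ∈ J, ξ' j = ξ ⟨j, hj⟩ ∧ α ⟨j, hj⟩ ≤ α' j := by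
  obtain ⟨y, -, hl, hy⟩ := exists_ray (n := n) hJ hξ hα
  obtain ⟨hj, h1, h2⟩ := hl.exists_mem_of_le (hJ' := hJ') hξ' (α' := α') (C := 0)
    (Eventually.of_forall fun k => by rw [← h, hy]; simp [Real.iSup_const_zero]) j
  exact ⟨hj, h1, by linarith⟩

theorem prodHoro_injective (hJ : J.Nonempty) (hξ : ∀ j, ‖ξ j‖ = 1) {α β : J → ℝ}
    (hα : IsLeast (range α) 0) (hβ : IsLeast (range β) 0)
    (h : (prodHoro hJ ξ α : ballProd n → ℝ) = prodHoro hJ ξ β) : α = β := by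
  funext j
  obtain ⟨_, -, h1⟩ := exists_mem_of_prodHoro_eq hξ hα hξ h j
  obtain ⟨_, -, h2⟩ := exists_mem_of_prodHoro_eq hξ hβ hξ h.symm j
  exact le_antisymm h1 h2

theorem exists_mem_of_detourCost_lt {hJ : J.Nonempty} {hJ' : J'.Nonempty} (hξ : ∀ j, ‖ξ j‖ = 1)
    (hα : IsLeast (range α) 0) (hξ' : ∀ j, ‖ξ' j‖ = 1) {c : ℝ}
    (h : detourCost (kob n) (origin n) (prodHoro hJ ξ α) (prodHoro hJ' ξ' α') < c) (j : J') :
    ∃ hj : j.1 ∈ J, ξ' j = ξ ⟨j, hj⟩ ∧ α ⟨j, hj⟩ - α' j ≤ c := by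
  obtain ⟨⟨z, hz⟩, hzc⟩ := iInf_lt_iff.1 h
  have hfreq := frequently_lt_of_liminf_lt (by isBoundedDefault) hzc
  have : (atTop ⊓ 𝓟 {k | ((kob n (origin n) (z k) + prodHoro hJ' ξ' α' (z k) : ℝ) : EReal)
      < c}).NeBot := frequently_mem_iff_neBot.1 hfreq
  set u := Ultrafilter.of (atTop ⊓ 𝓟 {k | ((kob n (origin n) (z k) +
    prodHoro hJ' ξ' α' (z k) : ℝ) : EReal) < c})
  have hu := Ultrafilter.of_le (atTop ⊓ 𝓟 {k | ((kob n (origin n) (z k) +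
    prodHoro hJ' ξ' α' (z k) : ℝ) : EReal) < c})
  have hbd : ∀ᶠ k in (u : Filter ℕ), kob n (origin n) (z k) + prodHoro hJ' ξ' α' (z k) ≤ c :=
    Eventually.mono (le_principal_iff.1 (hu.trans inf_le_right))
      fun k hk => (EReal.coe_lt_coe_iff.1 hk).le
  obtain ⟨J₀, hJ₀, ξ₀, α₀, hα₀, hl, heq⟩ := exists_eq_prodHoro_of_tendsto u
    (isHorofunction_prodHoro hJ hξ hα) fun x => (hz x).mono_left (hu.trans inf_le_left)
  obtain ⟨h0, h1, h2⟩ := hl.exists_mem_of_le hξ' hbd j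
  -- The data found along the ultrafilter are a priori different from `J`, `ξ`, `α`; equality of the
  -- two horofunctions identifies what is needed.
  obtain ⟨h3, h4, h5⟩ := exists_mem_of_prodHoro_eq hξ hα hl.norm_eq heq ⟨j, h0⟩
  exact ⟨h3, h1.trans h4, by linarith⟩

theorem detourCost_prodHoro (hJ : J.Nonempty) (hξ : ∀ j, ‖ξ j‖ = 1) (hα : IsLeast (range α) 0)
    (β : J → ℝ) : detourCost (kob n) (origin n) (prodHoro hJ ξ α) (prodHoro hJ ξ β) =
      ((⨆ j, (α j - β j) : ℝ) : EReal) := by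
  have : Nonempty J := hJ.to_subtype
  refine le_antisymm ?_ (not_lt.1 fun hlt => ?_)
  · obtain ⟨y, -, hl, hy⟩ := exists_ray (n := n) hJ hξ hα
    refine (iInf_le _ ⟨y, hl.tendsto hJ⟩).trans ?_
    simp only [hy, liminf_const, le_refl]
  · obtain ⟨c, hc, hc'⟩ := EReal.lt_iff_exists_real_btwn.1 hlt
    refine (EReal.coe_lt_coe_iff.1 hc').not_ge (ciSup_le fun j => ?_)
    obtain ⟨_, -, h⟩ := exists_mem_of_detourCost_lt hξ hα hξ hc j
    exact h

theorem detourDist_prodHoro (hJ : J.Nonempty) (hξ : ∀ j, ‖ξ j‖ = 1) {α β : J → ℝ}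
    (hα : IsLeast (range α) 0) (hβ : IsLeast (range β) 0) :
    detourDist (kob n) (origin n) (prodHoro hJ ξ α) (prodHoro hJ ξ β) =
      (varNorm (Submodule.Quotient.mk (α - β) : VarSpace J) : EReal) := by
  rw [detourDist, detourCost_prodHoro hJ hξ hα, detourCost_prodHoro hJ hξ hβ, ← EReal.coe_add,
    varNorm_mk]
  simp only [Pi.sub_apply, neg_sub]

/-- In `EReal` one has `⊤ + ⊥ = ⊥`, so a finite sum of costs bounds both of them only once `⊥` is
excluded. -/
theorem detourCost_ne_bot (hJ : J.Nonempty) (hJ' : J'.Nonempty) (hξ : ∀ j, ‖ξ j‖ = 1)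
    (hα : IsLeast (range α) 0) (hξ' : ∀ j, ‖ξ' j‖ = 1) :
    detourCost (kob n) (origin n) (prodHoro hJ ξ α) (prodHoro hJ' ξ' α') ≠ ⊥ := by
  intro h
  obtain ⟨i, hi⟩ := hJ'
  have h1 : ∀ c : ℝ, ∃ hj : i ∈ J, ξ' ⟨i, hi⟩ = ξ ⟨i, hj⟩ ∧ α ⟨i, hj⟩ - α' ⟨i, hi⟩ ≤ c := fun c =>
    exists_mem_of_detourCost_lt hξ hα hξ' (h ▸ EReal.bot_lt_coe c) ⟨i, hi⟩
  obtain ⟨hj, -, -⟩ := h1 0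
  obtain ⟨_, -, h2⟩ := h1 (α ⟨i, hj⟩ - α' ⟨i, hi⟩ - 1)
  linarith

theorem exists_mem_of_detourCost_ne_top {hJ : J.Nonempty} {hJ' : J'.Nonempty}
    (hξ : ∀ j, ‖ξ j‖ = 1) (hα : IsLeast (range α) 0) (hξ' : ∀ j, ‖ξ' j‖ = 1)
    (h : detourCost (kob n) (origin n) (prodHoro hJ ξ α) (prodHoro hJ' ξ' α') ≠ ⊤) (j : J') :
    ∃ hj : j.1 ∈ J, ξ' j = ξ ⟨j, hj⟩ := by
  obtain ⟨c, hc, -⟩ := EReal.lt_iff_exists_real_btwn.1 (lt_top_iff_ne_top.2 h)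
  obtain ⟨hj, h1, -⟩ := exists_mem_of_detourCost_lt hξ hα hξ' hc j
  exact ⟨hj, h1⟩

end Data

/-! ### Parts -/

variable {J : Finset (Fin q)} {ξ : (j : J) → EuclideanSpace ℂ (Fin (n j))} {α : J → ℝ}

theorem mem_part_prodHoro_iff (hJ : J.Nonempty) (hξ : ∀ j, ‖ξ j‖ = 1) (hα : IsLeast (range α) 0)
    (h : ballProd n → ℝ) : h ∈ part (kob n) (origin n) (prodHoro hJ ξ α) ↔
      ∃ β : J → ℝ, IsLeast (range β) 0 ∧ h = prodHoro hJ ξ β := by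
  constructor
  · rintro ⟨hB, hfin⟩
    obtain ⟨J', hJ', ξ', α', hξ', hα', rfl⟩ := (isHorofunction_iff h).1 hB.1
    have h1 := detourCost_ne_bot (α' := α') hJ hJ' hξ hα hξ'
    have h2 := detourCost_ne_bot (α' := α) hJ' hJ hξ' hα' hξ
    have h3 : detourCost (kob n) (origin n) (prodHoro hJ ξ α) (prodHoro hJ' ξ' α') ≠ ⊤ := by
      intro h
      rw [detourDist, h, EReal.top_add_of_ne_bot h2] at hfin
      exact lt_irrefl _ hfin
    have h4 : detourCost (kob n) (origin n) (prodHoro hJ' ξ' α') (prodHoro hJ ξ α) ≠ ⊤ := by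
      intro h
      rw [detourDist, h, EReal.add_top_of_ne_bot h1] at hfin
      exact lt_irrefl _ hfin
    have h5 := exists_mem_of_detourCost_ne_top hξ hα hξ' h3
    have h6 := exists_mem_of_detourCost_ne_top hξ' hα' hξ h4
    obtain rfl : J' = J := Finset.Subset.antisymm (fun j hj => (h5 ⟨j, hj⟩).1)
      (fun j hj => (h6 ⟨j, hj⟩).1)
    obtain rfl : ξ' = ξ := funext fun j => (h5 j).2
    exact ⟨α', hα', rfl⟩
  · rintro ⟨β, hβ, rfl⟩
    refine ⟨isBusemannPoint_prodHoro hJ hξ hβ, ?_⟩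
    rw [detourDist_prodHoro hJ hξ hα hβ]
    exact EReal.coe_lt_top _

/-- The constant difference is `≤ 0` at a zero of `α` and `≥ 0` at a zero of `β`. -/
theorem eq_of_mk_eq_mk {ι : Type*} {α β : ι → ℝ} (hα : IsLeast (range α) 0)
    (hβ : IsLeast (range β) 0)
    (h : (Submodule.Quotient.mk α : VarSpace ι) = Submodule.Quotient.mk β) : α = β := by
  obtain ⟨c, hc⟩ := Submodule.mem_span_singleton.1 ((Submodule.Quotient.eq _).1 h)
  have hc' : ∀ j, c = α j - β j := fun j => by simpa using congrFun hc j
  obtain ⟨⟨i, hi⟩, hα0⟩ := hα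
  obtain ⟨⟨k, hk⟩, hβ0⟩ := hβ
  have h1 : β i ≥ 0 := hβ0 ⟨i, rfl⟩
  have h2 : α k ≥ 0 := hα0 ⟨k, rfl⟩
  have h3 : c = 0 := by linarith [hc' i, hc' k]
  funext j
  linarith [hc' j]

theorem exists_isLeast_mk_eq {ι : Type*} [Finite ι] [Nonempty ι] (v : VarSpace ι) :
    ∃ α : ι → ℝ, IsLeast (range α) 0 ∧ Submodule.Quotient.mk α = v := by
  obtain ⟨x, rfl⟩ := Submodule.Quotient.mk_surjective _ v
  obtain ⟨i, hi⟩ := Finite.exists_min x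
  refine ⟨fun j => x j - x i, ⟨⟨i, sub_self _⟩, ?_⟩, ?_⟩
  · rintro _ ⟨j, rfl⟩
    exact sub_nonneg.2 (hi j)
  · refine (Submodule.Quotient.eq _).2 (Submodule.mem_span_singleton.2 ⟨-x i, ?_⟩)
    funext j
    simp

/-- The isometry takes a horofunction to the class of its normalized vector, unique by
`prodHoro_injective`. -/
theorem exists_part_equiv (hJ : J.Nonempty) (hξ : ∀ j, ‖ξ j‖ = 1) (hα : IsLeast (range α) 0) :
    ∃ Φ : part (kob n) (origin n) (prodHoro hJ ξ α) ≃ VarSpace J,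
      ∀ h₁ h₂ : part (kob n) (origin n) (prodHoro hJ ξ α),
        detourDist (kob n) (origin n) h₁ h₂ = (varNorm (Φ h₁ - Φ h₂) : EReal) := by
  have : Nonempty J := hJ.to_subtype
  choose β hβ hβ' using fun h : part (kob n) (origin n) (prodHoro hJ ξ α) =>
    (mem_part_prodHoro_iff hJ hξ hα h.1).1 h.2
  have hinj : Function.Injective fun h => (Submodule.Quotient.mk (β h) : VarSpace J) := by
    intro h₁ h₂ h
    rw [Subtype.ext_iff, hβ' h₁, hβ' h₂, eq_of_mk_eq_mk (hβ h₁) (hβ h₂) h]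
  have hsurj : Function.Surjective fun h => (Submodule.Quotient.mk (β h) : VarSpace J) := by
    intro v
    obtain ⟨γ, hγ, rfl⟩ := exists_isLeast_mk_eq v
    have hmem := (mem_part_prodHoro_iff hJ hξ hα _).2 ⟨γ, hγ, rfl⟩
    exact ⟨⟨_, hmem⟩, congrArg Submodule.Quotient.mk
      (prodHoro_injective hJ hξ (hβ _) hγ (hβ' ⟨_, hmem⟩).symm)⟩
  refine ⟨Equiv.ofBijective _ ⟨hinj, hsurj⟩, fun h₁ h₂ => ?_⟩
  have key := detourDist_prodHoro (n := n) hJ hξ (hβ h₁) (hβ h₂)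
  rw [← hβ', ← hβ'] at key
  exact key

end Horofunctions

end KobHoro

theorem corollary3p2 (q : ℕ) (n : Fin q → ℕ) :
    (∀ h : KobHoro.ballProd n → ℝ,
      KobHoro.IsHorofunction (KobHoro.kob n) (KobHoro.origin n) h ↔
        ∃ (J : Finset (Fin q)) (hJ : J.Nonempty)
          (ξ : (j : J) → EuclideanSpace ℂ (Fin (n j))) (α : J → ℝ),
          (∀ j, ‖ξ j‖ = 1) ∧ IsLeast (Set.range α) 0 ∧ h = KobHoro.prodHoro hJ ξ α) ∧
    (∀ h : KobHoro.ballProd n → ℝ,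
      KobHoro.IsHorofunction (KobHoro.kob n) (KobHoro.origin n) h →
        KobHoro.IsBusemannPoint (KobHoro.kob n) (KobHoro.origin n) h) ∧
    (∀ (J : Finset (Fin q)) (hJ : J.Nonempty)
      (ξ : (j : J) → EuclideanSpace ℂ (Fin (n j))) (α : J → ℝ),
      (∀ j, ‖ξ j‖ = 1) → IsLeast (Set.range α) 0 →
        ∃ Φ : KobHoro.part (KobHoro.kob n) (KobHoro.origin n) (KobHoro.prodHoro hJ ξ α) ≃
            KobHoro.VarSpace J,
          ∀ h₁ h₂ : KobHoro.part (KobHoro.kob n) (KobHoro.origin n) (KobHoro.prodHoro hJ ξ α),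
            KobHoro.detourDist (KobHoro.kob n) (KobHoro.origin n) h₁ h₂ =
              (KobHoro.varNorm (Φ h₁ - Φ h₂) : EReal)) := by
  exact ⟨KobHoro.isHorofunction_iff, fun _ hh => hh.isBusemannPoint,
    fun _ hJ _ _ hξ hα => KobHoro.exists_part_equiv hJ hξ hα⟩
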